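/- **Setting.** Let $d\ge 1$, let $(\Omega,P)$ be a probability space with an ergodic, measure-preserving action $(\tau_x)_{x\in\mathbb R^d}$ of $\mathbb R^d$, and suppose that the unitary group $(T_xf)(\omega)=f(\tau_{-x}\omega)$ on $L^2(\Omega,P)$ (complex-valued) is strongly continuous. Write $\langle\cdot\rangle$ for the average with respect to $P$. Let $L_i f=\frac{\partial}{\partial x_i}T_xf|_{x=0}$ be the generators, $\nabla=(L_1,\dots,L_d)$, and $\mathscr H=L^2(\Omega,P)^d$ with inner product $\langle\xi,\zeta\rangle=\langle\xi\cdot\bar\zeta\rangle$. Let $\mathscr H_\times$ be the space of $\xi\in\mathscr H$ with $\langle\xi\rangle=0$ and $L_i\xi_j-L_j\xi_i=0$ weakly for all $i,j$. Let $\mathscr H^{1,2}_0$ be the completion of $\{f\in\bigcap_i\mathrm{Dom}(L_i):\langle f\rangle=0\}$ for the inner product $\langle\nabla f\cdot\overline{\nabla g}\rangle$; $\nabla$ extends to an isometry $\mathscr H^{1,2}_0\to\mathscr H$. For $\zeta\in\mathscr H$ let $(\nabla^*\nabla)^{-1}\nabla^*\zeta$ be the unique weak solution $u\in\mathscr H^{1,2}_0$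 of $\nabla^*\nabla u=\nabla^*\zeta$, and let $\Gamma=\nabla(\nabla^*\nabla)^{-1}\nabla^*$, a bounded operator on $\mathscr H$. Let $R:\Omega\to SO(d)$ be measurable, $C=\mathrm{diag}(1,0,\dots,0)$, $X_1=R^TCR$, $X_2=R^T(I-C)R$ (multiplication operators on $\mathscr H$), and $\mathbf M=X_1\Gamma X_1$. Consider potentials $f=\xi\cdot x+g$ with $\xi\in\mathbb C^d$, $g\in\mathscr H^{1,2}_0$, put $\nabla f=\xi+\nabla g$, and let $\mathscr H^{1,2}_{X_1}$ be the Hilbert space obtained from the space of these potentials and the form $\langle f,g\rangle_{1,2}=\langle X_1\nabla f\cdot\overline{\nabla g}\rangle$, by identifying potentials whose difference $f$ has $X_1\nabla f=0$ and completing. The map $f\mapsto X_1\nabla f$ extends to an isometry $X_1\nabla:\mathscr H^{1,2}_{X_1}\to\mathscr H$, and $M f=(\nabla^*\nabla)^{-1}\nabla^*X_1\nabla f$ extends to a bounded operator $M$ on $\mathscr H^{1,2}_{X_1}$. For $\sigma_1,\sigma_2\in\mathbb C$ with $\sigma_2\ne0$ put $\sigma=\sigma_1X_1+\sigma_2X_2$,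 $h=\sigma_1/\sigma_2$, $s=1/(1-h)$. For a constant vector $E_0\in\mathbb C^d$, the fluctuating field $E_f\in\mathscr H_\times$ is a solution of $\langle\sigma(E_0+E_f)\cdot\bar\xi\rangle=0$ for all $\xi\in\mathscr H_\times$; the effective conductivity matrix $\sigma^*$ is defined by $\langle\sigma(E_0+E_f)\rangle=\sigma^*E_0$ for all $E_0$. A resolution of the identity of a bounded operator $T$ is an increasing right-continuous family of orthogonal projections $Q(\lambda)$, $\lambda\in\mathbb R$, with strong limits $0$ at $-\infty$ and $I$ at $+\infty$, such that $T=\int\lambda\,dQ(\lambda)$ weakly. **Theorem.** The operators $\mathbf M$ on $\mathscr H$ and $M$ on $\mathscr H^{1,2}_{X_1}$ are self-adjoint, and each has exactly one resolution of the identity, $Q(\lambda)$ and $\tilde Q(\lambda)$ respectively. They are related by $$X_1\bigl(\nabla\tilde Q(\lambda)-Q(\lambda)\nabla\bigr)f=0\qquad\text{for all }\lambda\in\mathbb R\text{ and all potentials } f=\xi\cdot x+g .$$ Let $j\in\{1,\dots,d\}$, $0\neq E_0\in\mathbb C$ and $\phi_0=E_0\,e_j\cdot x$, so that $\nabla\phi_0=E_0e_j$.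 There are finite positive measures $\nu_{jj}$, $\mu_{jj}$ on $\mathbb R$ with no mass outside $[0,1]$ such that $$d\nu_{jj}(\lambda)=d\langle\tilde Q(\lambda)\phi_0/E_0,\phi_0/E_0\rangle_{1,2}=d\langle X_1\nabla\tilde Q(\lambda)\phi_0/E_0\cdot\overline{\nabla\phi_0/E_0}\rangle,\qquad d\mu_{jj}(\lambda)=d\langle Q(\lambda)X_1e_j,e_j\rangle,$$ and $\nu_{jj}=\mu_{jj}$. Moreover, for all $\sigma_1,\sigma_2\in\mathbb C$ with $\sigma_2\neq0$, $h\notin(-\infty,0]$ and $h\ne1$, for each constant vector there is a unique fluctuating field, the matrix $\sigma^*$ exists and is unique, and $$\sigma^*_{jj}/\sigma_2=1-\int_0^1\frac{d\nu_{jj}(\lambda)}{s-\lambda},$$ where the integrand is integrable. -/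

import Mathlib

open MeasureTheory Filter Topology

namespace UniaxialComposite

noncomputable section

/-! ### Resolutions of the identity and their Stieltjes measures -/

/-- `μ` is the (finite, positive) Stieltjes measure `dF` of the function `F` of the spectral
variable, where `F` vanishes at `-∞` and is continuous from the right. -/
structure IsStieltjesMeasure (μ : Measure ℝ) (F : ℝ → ℂ) : Prop where
  isFinite : IsFiniteMeasure μ
  eq_measure_Iic : ∀ t : ℝ, F t = (μ.real (Set.Iic t) : ℂ)

/-- `Q` is a resolution of the identity for the bounded operator `T` on a Hilbert space: an
increasing, right-continuous family of orthogonal projections, with strong limits `0` at `-∞` and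
`I` at `+∞`, such that `T = ∫ t dQ(t)`. (The last identity is the identity of quadratic forms
`⟨T x, x⟩ = ∫ t d⟨Q(t) x, x⟩`, which over `ℂ` determines the sesquilinear forms.) -/
structure IsResolutionOfIdentity {H : Type*} [NormedAddCommGroup H] [InnerProductSpace ℂ H]
    [CompleteSpace H] (T : H →L[ℂ] H) (Q : ℝ → H →L[ℂ] H) : Prop where
  isStarProjection : ∀ t, IsStarProjection (Q t)
  comp_of_le : ∀ t u, t ≤ u → (Q t).comp (Q u) = Q t
  tendsto_right : ∀ (t : ℝ) (x : H), Tendsto (fun u => Q u x) (𝓝[>] t) (𝓝 (Q t x))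
  tendsto_atBot : ∀ x : H, Tendsto (fun u => Q u x) atBot (𝓝 0)
  tendsto_atTop : ∀ x : H, Tendsto (fun u => Q u x) atTop (𝓝 x)
  integral_eq : ∀ x : H, ∃ μ : Measure ℝ, IsStieltjesMeasure μ (fun t => inner ℂ x (Q t x)) ∧
    Integrable (fun t : ℝ => t) μ ∧ ((∫ t, t ∂μ : ℝ) : ℂ) = inner ℂ x (T x)

/-! ### Hilbert space generated by a semi-inner product `⟨A v, A w⟩` -/

section Energy

variable {V F : Type*} [AddCommGroup V] [Module ℂ V] [NormedAddCommGroup F] [InnerProductSpace ℂ F]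

/-- The vector space `V` with the semi-inner product `⟨v, w⟩ := ⟨A v, A w⟩`. -/
def PreEnergy (_A : V →ₗ[ℂ] F) : Type _ := V

instance (A : V →ₗ[ℂ] F) : AddCommGroup (PreEnergy A) := inferInstanceAs (AddCommGroup V)

instance (A : V →ₗ[ℂ] F) : Module ℂ (PreEnergy A) := inferInstanceAs (Module ℂ V)

/-- The identity map from `V` to `V` with its new semi-inner product. -/
def toPreEnergy (A : V →ₗ[ℂ] F) : V ≃ₗ[ℂ] PreEnergy A := LinearEquiv.refl ℂ V

/-- The map `A`, seen on `V` with the semi-inner product that it defines. -/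
def preEnergyMap (A : V →ₗ[ℂ] F) : PreEnergy A →ₗ[ℂ] F := A ∘ₗ (toPreEnergy A).symm.toLinearMap

/-- The semi-inner product `⟨A v, A w⟩`. -/
abbrev preEnergyCore (A : V →ₗ[ℂ] F) : PreInnerProductSpace.Core ℂ (PreEnergy A) where
  inner v w := inner ℂ (preEnergyMap A v) (preEnergyMap A w)
  conj_inner_symm _ _ := inner_conj_symm _ _
  re_inner_nonneg _ := inner_self_nonneg
  add_left _ _ _ := by rw [map_add, inner_add_left]
  smul_left _ _ _ := by rw [map_smul, inner_smul_left]

instance (A : V →ₗ[ℂ] F) : SeminormedAddCommGroup (PreEnergy A) :=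
  InnerProductSpace.Core.toSeminormedAddCommGroup (c := preEnergyCore A)

instance (A : V →ₗ[ℂ] F) : InnerProductSpace ℂ (PreEnergy A) :=
  InnerProductSpace.ofCore (preEnergyCore A)

theorem preEnergy_inner (A : V →ₗ[ℂ] F) (v w : PreEnergy A) :
    inner ℂ v w = inner ℂ (preEnergyMap A v) (preEnergyMap A w) := rfl

theorem preEnergy_norm (A : V →ₗ[ℂ] F) (v : PreEnergy A) : ‖v‖ = ‖preEnergyMap A v‖ := by
  rw [norm_eq_sqrt_re_inner (𝕜 := ℂ) v, norm_eq_sqrt_re_inner (𝕜 := ℂ) (preEnergyMap A v)]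
  rfl

/-- The Hilbert space obtained from `V` with the semi-inner product `⟨A v, A w⟩`, by identifying
elements that differ by an element of zero norm and completing. -/
abbrev Energy (A : V →ₗ[ℂ] F) : Type _ := UniformSpace.Completion (PreEnergy A)

/-- The class of an element of `V` in the Hilbert space `Energy A`. -/
def toEnergy (A : V →ₗ[ℂ] F) : V →ₗ[ℂ] Energy A :=
  (UniformSpace.Completion.toComplL (𝕜 := ℂ) (E := PreEnergy A)).toLinearMap ∘ₗ
    (toPreEnergy A).toLinearMap

theorem denseRange_toEnergy (A : V →ₗ[ℂ] F) : DenseRange (toEnergy A) :=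
  UniformSpace.Completion.denseRange_coe (α := PreEnergy A)

theorem inner_toEnergy (A : V →ₗ[ℂ] F) (v w : V) :
    inner ℂ (toEnergy A v) (toEnergy A w) = inner ℂ (A v) (A w) :=
  UniformSpace.Completion.inner_coe (𝕜 := ℂ) (toPreEnergy A v) (toPreEnergy A w)

/-- Extension by continuity to `Energy A` of a linear map that is bounded for the seminorm
`‖A v‖`. -/
def energyLift {K : Type*} [NormedAddCommGroup K] [InnerProductSpace ℂ K] [CompleteSpace K]
    (A : V →ₗ[ℂ] F) (B : V →ₗ[ℂ] K) (C : ℝ) (hB : ∀ v, ‖B v‖ ≤ C * ‖A v‖) : Energy A →L[ℂ] K :=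
  ((B ∘ₗ (toPreEnergy A).symm.toLinearMap).mkContinuous C
    (fun v => by rw [preEnergy_norm]; exact hB _)).extend
      (UniformSpace.Completion.toComplL (𝕜 := ℂ) (E := PreEnergy A))

theorem energyLift_toEnergy {K : Type*} [NormedAddCommGroup K] [InnerProductSpace ℂ K]
    [CompleteSpace K] (A : V →ₗ[ℂ] F) (B : V →ₗ[ℂ] K) (C : ℝ) (hB : ∀ v, ‖B v‖ ≤ C * ‖A v‖)
    (v : V) : energyLift A B C hB (toEnergy A v) = B v :=
  ContinuousLinearMap.extend_eq _ (UniformSpace.Completion.denseRange_coe (α := PreEnergy A))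
    (UniformSpace.Completion.isUniformInducing_coe (PreEnergy A)) (toPreEnergy A v)

end Energy

/-! ### Random fields, translations, and the generalized gradient -/

section Fields

variable {d : ℕ} {Ω : Type*} [MeasurableSpace Ω] (P : Measure Ω)

/-- The Hilbert space `⨁_{i=1}^d L²(Ω, P)` of random vector fields, with inner product
`∑ i, ⟨ξ_i, ζ_i⟩`. -/
abbrev Field (d : ℕ) {Ω : Type*} [MeasurableSpace Ω] (P : Measure Ω) : Type _ :=
  PiLp 2 (fun _ : Fin d => Lp ℂ 2 P)

/-- The ensemble average of a random vector field. -/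
def mean (ξ : Field d P) : Fin d → ℂ := fun i => ∫ ω, (ξ i : Ω → ℂ) ω ∂P

/-- Constant vectors as (non-random) fields. -/
def constField (d : ℕ) [IsFiniteMeasure P] : EuclideanSpace ℂ (Fin d) →L[ℂ] Field d P :=
  (PiLp.continuousLinearEquiv 2 ℂ (fun _ : Fin d => Lp ℂ 2 P)).symm.toContinuousLinearMap.comp
    (ContinuousLinearMap.pi fun i =>
      (Lp.constL 2 P ℂ : ℂ →L[ℂ] Lp ℂ 2 P).comp
        (PiLp.proj 2 (fun _ : Fin d => ℂ) i : EuclideanSpace ℂ (Fin d) →L[ℂ] ℂ))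

section Translations

variable [AddAction (EuclideanSpace ℝ (Fin d)) Ω] [MeasurableConstVAdd (EuclideanSpace ℝ (Fin d)) Ω]
  [VAddInvariantMeasure (EuclideanSpace ℝ (Fin d)) Ω P]

/-- The operator `(T_x f)(ω) = f(τ_{-x} ω)` on `L²(Ω, P)`, where `τ_x ω = x +ᵥ ω`. -/
def translate (x : EuclideanSpace ℝ (Fin d)) : Lp ℂ 2 P →ₗᵢ[ℂ] Lp ℂ 2 P :=
  Lp.compMeasurePreservingₗᵢ ℂ (fun ω => -x +ᵥ ω) (measurePreserving_vadd (-x) P)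

/-- The orbit `t ↦ T_{t e_i} f` of the `i`-th one-parameter group. -/
def orbit (i : Fin d) (f : Lp ℂ 2 P) (t : ℝ) : Lp ℂ 2 P :=
  translate P (EuclideanSpace.single i t) f

/-- The infinitesimal generator `L_i` of the `i`-th one-parameter group of translations
(meaningful on `{f | DifferentiableAt ℝ (orbit P i f) 0}`, its domain). -/
def generator (i : Fin d) (f : Lp ℂ 2 P) : Lp ℂ 2 P := deriv (orbit P i f) 0

theorem orbit_add (i : Fin d) (f g : Lp ℂ 2 P) : orbit P i (f + g) = orbit P i f + orbit P i g := by
  funext t; exact map_add _ _ _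

theorem orbit_smul (i : Fin d) (c : ℂ) (f : Lp ℂ 2 P) : orbit P i (c • f) = c • orbit P i f := by
  funext t; exact map_smul _ _ _

/-- The intersection of the domains of the generators `L_1, …, L_d`. -/
def generatorDomain : Submodule ℂ (Lp ℂ 2 P) where
  carrier := {f | ∀ i : Fin d, DifferentiableAt ℝ (orbit P i f) 0}
  add_mem' hf hg i := by rw [orbit_add]; exact (hf i).add (hg i)
  zero_mem' i := by
    have : orbit P i (0 : Lp ℂ 2 P) = fun _ => 0 := by funext t; exact map_zero _
    rw [this]; exact differentiableAt_const _
  smul_mem' c f hf i := by rw [orbit_smul]; exact (hf i).const_smul c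

/-- The potentials: `f ∈ L²(Ω, P)` with `L_i f ∈ L²(Ω, P)` for all `i`, and `⟨f⟩ = 0`. -/
def potentialDomain [IsFiniteMeasure P] : Submodule ℂ (Lp ℂ 2 P) where
  carrier := {f | f ∈ generatorDomain (d := d) P ∧ ∫ ω, (f : Ω → ℂ) ω ∂P = 0}
  add_mem' := by
    rintro f g ⟨hf, hf0⟩ ⟨hg, hg0⟩
    refine ⟨add_mem hf hg, ?_⟩
    rw [integral_congr_ae (Lp.coeFn_add f g)]
    simp only [Pi.add_apply]
    rw [integral_add ((Lp.memLp f).integrable (by norm_num))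
      ((Lp.memLp g).integrable (by norm_num)), hf0, hg0, add_zero]
  zero_mem' := by
    refine ⟨zero_mem _, ?_⟩
    rw [integral_congr_ae (Lp.coeFn_zero ℂ 2 P)]
    simp
  smul_mem' := by
    rintro c f ⟨hf, hf0⟩
    refine ⟨Submodule.smul_mem _ c hf, ?_⟩
    rw [integral_congr_ae (Lp.coeFn_smul c f)]
    simp only [Pi.smul_apply]
    rw [integral_smul, hf0, smul_zero]

/-- The generalized gradient `∇ f = (L_1 f, …, L_d f)`. -/
def gradient (d : ℕ) {Ω : Type*} [MeasurableSpace Ω] (P : Measure Ω)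
    [AddAction (EuclideanSpace ℝ (Fin d)) Ω] [MeasurableConstVAdd (EuclideanSpace ℝ (Fin d)) Ω]
    [VAddInvariantMeasure (EuclideanSpace ℝ (Fin d)) Ω P] [IsFiniteMeasure P] :
    potentialDomain (d := d) P →ₗ[ℂ] Field d P where
  toFun f := WithLp.toLp 2 fun i => generator P i f
  map_add' f g := by
    ext1 i
    change deriv (orbit P i ((f : Lp ℂ 2 P) + g)) 0 = deriv (orbit P i f) 0 + deriv (orbit P i g) 0
    rw [orbit_add]
    exact deriv_add (f.2.1 i) (g.2.1 i)
  map_smul' c f := by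
    ext1 i
    change deriv (orbit P i (c • (f : Lp ℂ 2 P))) 0 = c • deriv (orbit P i f) 0
    rw [orbit_smul]
    exact deriv_const_smul c (f.2.1 i)

/-- The Hilbert space of curl-free fields: `L_i ξ_j - L_j ξ_i = 0` weakly, and `⟨ξ⟩ = 0`. -/
def curlFree (d : ℕ) {Ω : Type*} [MeasurableSpace Ω] (P : Measure Ω)
    [AddAction (EuclideanSpace ℝ (Fin d)) Ω] [MeasurableConstVAdd (EuclideanSpace ℝ (Fin d)) Ω]
    [VAddInvariantMeasure (EuclideanSpace ℝ (Fin d)) Ω P] : Set (Field d P) :=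
  {ξ | (∀ i j : Fin d, ∀ f ∈ generatorDomain (d := d) P,
      inner ℂ (generator P i f) (ξ j) - inner ℂ (generator P j f) (ξ i) = 0) ∧ mean P ξ = 0}

variable [IsFiniteMeasure P]

/-- The Sobolev-type Hilbert space of (mean-zero) potentials with inner product `⟨∇f, ∇g⟩`. -/
abbrev Sobolev (d : ℕ) {Ω : Type*} [MeasurableSpace Ω] (P : Measure Ω)
    [AddAction (EuclideanSpace ℝ (Fin d)) Ω] [MeasurableConstVAdd (EuclideanSpace ℝ (Fin d)) Ω]
    [VAddInvariantMeasure (EuclideanSpace ℝ (Fin d)) Ω P] [IsFiniteMeasure P] : Type _ :=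
  Energy (gradient d P)

/-- The gradient on the completed space of potentials. -/
def grad (d : ℕ) {Ω : Type*} [MeasurableSpace Ω] (P : Measure Ω)
    [AddAction (EuclideanSpace ℝ (Fin d)) Ω] [MeasurableConstVAdd (EuclideanSpace ℝ (Fin d)) Ω]
    [VAddInvariantMeasure (EuclideanSpace ℝ (Fin d)) Ω P] [IsFiniteMeasure P] :
    Sobolev d P →L[ℂ] Field d P :=
  energyLift (gradient d P) (gradient d P) 1 (fun v => by rw [one_mul])

/-- The operator `(∇*∇)⁻¹∇*` from vector fields to potentials: `u = (∇*∇)⁻¹∇* ζ` is the weak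
solution of `∇*∇ u = ∇* ζ`, see `invLaplaceDiv_eq_iff`. -/
def invLaplaceDiv (d : ℕ) {Ω : Type*} [MeasurableSpace Ω] (P : Measure Ω)
    [AddAction (EuclideanSpace ℝ (Fin d)) Ω] [MeasurableConstVAdd (EuclideanSpace ℝ (Fin d)) Ω]
    [VAddInvariantMeasure (EuclideanSpace ℝ (Fin d)) Ω P] [IsFiniteMeasure P] :
    Field d P →L[ℂ] Sobolev d P :=
  ContinuousLinearMap.adjoint (grad d P)

theorem grad_toEnergy (f : potentialDomain (d := d) P) :
    grad d P (toEnergy (gradient d P) f) = gradient d P f :=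
  energyLift_toEnergy _ _ _ _ f

theorem inner_grad (u v : Sobolev d P) :
    inner ℂ (grad d P u) (grad d P v) = inner ℂ u v := by
  have h1 : ∀ (f : potentialDomain (d := d) P) (v : Sobolev d P),
      inner ℂ (grad d P (toEnergy (gradient d P) f)) (grad d P v) =
        inner ℂ (toEnergy (gradient d P) f) v := by
    intro f v
    have hc1 : Continuous fun w : Sobolev d P =>
      inner ℂ (grad d P (toEnergy (gradient d P) f)) (grad d P w) := by fun_prop
    have hc2 : Continuous fun w : Sobolev d P =>
      inner ℂ (toEnergy (gradient d P) f) w := by fun_prop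
    refine congrFun ((denseRange_toEnergy (gradient d P)).equalizer hc1 hc2 ?_) v
    funext g
    simp only [Function.comp_apply]
    rw [inner_toEnergy, grad_toEnergy, grad_toEnergy]
  have hc1 : Continuous fun w : Sobolev d P => inner ℂ (grad d P w) (grad d P v) := by fun_prop
  have hc2 : Continuous fun w : Sobolev d P => inner ℂ w v := by fun_prop
  refine congrFun ((denseRange_toEnergy (gradient d P)).equalizer hc1 hc2 ?_) u
  funext f
  exact h1 f v

/-- `(∇*∇)⁻¹∇* ζ` is the unique weak solution `u` of `∇*∇ u = ∇* ζ`. -/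
theorem invLaplaceDiv_eq_iff (ζ : Field d P) (u : Sobolev d P) :
    invLaplaceDiv d P ζ = u ↔
      ∀ g : potentialDomain (d := d) P,
        inner ℂ (gradient d P g) (grad d P u) = inner ℂ (gradient d P g) ζ := by
  have key : ∀ g : potentialDomain (d := d) P,
      inner ℂ (gradient d P g) (grad d P u) = inner ℂ (toEnergy (gradient d P) g) u := by
    intro g; rw [← grad_toEnergy, inner_grad]
  have key2 : ∀ g : potentialDomain (d := d) P,
      inner ℂ (gradient d P g) ζ =
        inner ℂ (toEnergy (gradient d P) g) (invLaplaceDiv d P ζ) := by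
    intro g; rw [invLaplaceDiv, ContinuousLinearMap.adjoint_inner_right, grad_toEnergy]
  constructor
  · rintro rfl g
    rw [key, key2]
  · intro h
    refine ext_inner_left ℂ fun w => ?_
    have hc1 : Continuous fun w : Sobolev d P => inner ℂ w (invLaplaceDiv d P ζ) := by fun_prop
    have hc2 : Continuous fun w : Sobolev d P => inner ℂ w u := by fun_prop
    refine congrFun ((denseRange_toEnergy (gradient d P)).equalizer hc1 hc2 ?_) w
    funext g
    simp only [Function.comp_apply]
    rw [← key, ← key2, h g]

/-- The projection `Γ = ∇(∇*∇)⁻¹∇*`. -/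
def Gam (d : ℕ) {Ω : Type*} [MeasurableSpace Ω] (P : Measure Ω)
    [AddAction (EuclideanSpace ℝ (Fin d)) Ω] [MeasurableConstVAdd (EuclideanSpace ℝ (Fin d)) Ω]
    [VAddInvariantMeasure (EuclideanSpace ℝ (Fin d)) Ω P] [IsFiniteMeasure P] :
    Field d P →L[ℂ] Field d P :=
  (grad d P).comp (invLaplaceDiv d P)

end Translations

/-! ### Uniaxial polycrystalline media -/

/-- Multiplication of random variables by a bounded measurable function. -/
def mulOp (a : Ω → ℝ) (ha : Measurable a) (C : ℝ) (hC : ∀ ω, |a ω| ≤ C) :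
    Lp ℂ 2 P →L[ℂ] Lp ℂ 2 P :=
  (ContinuousLinearMap.mul ℂ ℂ).holderL P ⊤ 2 2
    ((memLp_top_of_bound (μ := P) (f := fun ω => (a ω : ℂ))
      (Complex.measurable_ofReal.comp ha).aestronglyMeasurable C
      (Filter.Eventually.of_forall fun ω => by
        rw [Complex.norm_real, Real.norm_eq_abs]; exact hC ω)).toLp _)

theorem mulOp_apply (a : Ω → ℝ) (ha : Measurable a) (C : ℝ) (hC : ∀ ω, |a ω| ≤ C) (f : Lp ℂ 2 P) :
    (mulOp P a ha C hC f : Ω → ℂ) =ᵐ[P] fun ω => (a ω : ℂ) * (f : Ω → ℂ) ω := by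
  refine ((ContinuousLinearMap.mul ℂ ℂ).coeFn_holder (r := 2) _ f).trans ?_
  filter_upwards [MemLp.coeFn_toLp (memLp_top_of_bound (μ := P) (f := fun ω => (a ω : ℂ))
      (Complex.measurable_ofReal.comp ha).aestronglyMeasurable C
      (Filter.Eventually.of_forall fun ω => by
        rw [Complex.norm_real, Real.norm_eq_abs]; exact hC ω))] with ω hω
  rw [hω]
  rfl

/-- Multiplication of random vector fields by a bounded measurable matrix-valued function,
`(A ξ)_i = ∑ j, A_ij ξ_j`. -/
def matrixOp (A : Ω → Matrix (Fin d) (Fin d) ℝ) (hA : ∀ i j, Measurable fun ω => A ω i j) (C : ℝ)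
    (hC : ∀ ω i j, |A ω i j| ≤ C) : Field d P →L[ℂ] Field d P :=
  (PiLp.continuousLinearEquiv 2 ℂ (fun _ : Fin d => Lp ℂ 2 P)).symm.toContinuousLinearMap.comp
    (ContinuousLinearMap.pi fun i => ∑ j : Fin d,
      (mulOp P (fun ω => A ω i j) (hA i j) C (fun ω => hC ω i j)).comp
        (PiLp.proj 2 (fun _ : Fin d => Lp ℂ 2 P) j))

/-- A measurable field of rotation matrices, giving the local crystal orientations. -/
structure Orientation (d : ℕ) (Ω : Type*) [MeasurableSpace Ω] where
  rot : Ω → Matrix.specialOrthogonalGroup (Fin d) ℝ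
  measurable_rot : ∀ i j, Measurable fun ω => (rot ω : Matrix (Fin d) (Fin d) ℝ) i j

/-- The matrix field `Rᵀ C R`. -/
def Orientation.conj (R : Orientation d Ω) (C : Matrix (Fin d) (Fin d) ℝ) (ω : Ω) :
    Matrix (Fin d) (Fin d) ℝ :=
  (R.rot ω : Matrix (Fin d) (Fin d) ℝ).transpose * C * (R.rot ω : Matrix (Fin d) (Fin d) ℝ)

theorem Orientation.conj_apply (R : Orientation d Ω) (C : Matrix (Fin d) (Fin d) ℝ) (ω : Ω)
    (i j : Fin d) : R.conj C ω i j = ∑ l, (∑ k, (R.rot ω : Matrix (Fin d) (Fin d) ℝ) k i * C k l) *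
      (R.rot ω : Matrix (Fin d) (Fin d) ℝ) l j := by
  simp only [Orientation.conj, Matrix.mul_apply, Matrix.transpose_apply]

theorem Orientation.measurable_conj (R : Orientation d Ω) (C : Matrix (Fin d) (Fin d) ℝ)
    (i j : Fin d) : Measurable fun ω => R.conj C ω i j := by
  simp only [Orientation.conj_apply]
  refine Finset.measurable_sum _ fun l _ => Measurable.mul ?_ (R.measurable_rot l j)
  exact Finset.measurable_sum _ fun k _ => (R.measurable_rot k i).mul_const _

theorem Orientation.abs_conj_le (R : Orientation d Ω) (C : Matrix (Fin d) (Fin d) ℝ) (ω : Ω)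
    (i j : Fin d) : |R.conj C ω i j| ≤ ∑ l, ∑ k, |C k l| := by
  have hb : ∀ k l, |(R.rot ω : Matrix (Fin d) (Fin d) ℝ) k l| ≤ 1 := fun k l => by
    have := entry_norm_bound_of_unitary
      (Matrix.mem_specialOrthogonalGroup_iff.1 (R.rot ω).2).1 k l
    rwa [Real.norm_eq_abs] at this
  rw [Orientation.conj_apply]
  refine (Finset.abs_sum_le_sum_abs _ _).trans (Finset.sum_le_sum fun l _ => ?_)
  rw [abs_mul]
  refine (mul_le_of_le_one_right (abs_nonneg _) (hb l j)).trans ?_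
  refine (Finset.abs_sum_le_sum_abs _ _).trans (Finset.sum_le_sum fun k _ => ?_)
  rw [abs_mul]
  exact mul_le_of_le_one_left (abs_nonneg _) (hb k i)

/-- Multiplication by the matrix field `Rᵀ C R`. -/
def Orientation.op (R : Orientation d Ω) (C : Matrix (Fin d) (Fin d) ℝ) :
    Field d P →L[ℂ] Field d P :=
  matrixOp P (R.conj C) (R.measurable_conj C) (∑ l, ∑ k, |C k l|) (R.abs_conj_le C)

/-- `C = diag(1, 0, …, 0)`. -/
def axisMatrix (d : ℕ) [NeZero d] : Matrix (Fin d) (Fin d) ℝ := Matrix.diagonal (Pi.single 0 1)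

variable [NeZero d] (R : Orientation d Ω)

/-- Multiplication by the random projection matrix `X₁ = Rᵀ C R`. -/
def X₁ : Field d P →L[ℂ] Field d P := R.op P (axisMatrix d)

/-- Multiplication by the random projection matrix `X₂ = Rᵀ (I - C) R`. -/
def X₂ : Field d P →L[ℂ] Field d P := R.op P (1 - axisMatrix d)

/-- Multiplication by the local conductivity matrix `σ = σ₁ X₁ + σ₂ X₂`. -/
def conductivity (σ₁ σ₂ : ℂ) : Field d P →L[ℂ] Field d P := σ₁ • X₁ P R + σ₂ • X₂ P R

variable [IsFiniteMeasure P]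
  [AddAction (EuclideanSpace ℝ (Fin d)) Ω] [MeasurableConstVAdd (EuclideanSpace ℝ (Fin d)) Ω]
  [VAddInvariantMeasure (EuclideanSpace ℝ (Fin d)) Ω P]

/-- `Ef` is the fluctuating part of the electric field `E = E₀ + Ef` with average `E₀`: it is
curl-free with mean zero, and the current `J = σ E` is divergence-free, in the weak sense. -/
def IsFluctuatingField (σ₁ σ₂ : ℂ) (E₀ : EuclideanSpace ℂ (Fin d)) (Ef : Field d P) : Prop :=
  Ef ∈ curlFree d P ∧
    ∀ ξ ∈ curlFree d P, inner ℂ ξ (conductivity P R σ₁ σ₂ (constField P d E₀ + Ef)) = 0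

/-- `S` is the effective conductivity matrix: `⟨J⟩ = S ⟨E⟩` for all the electric fields `E`, with
arbitrary average `⟨E⟩ = E₀`, and the corresponding currents `J = σ E`. -/
def IsEffectiveConductivity (σ₁ σ₂ : ℂ) (S : Matrix (Fin d) (Fin d) ℂ) : Prop :=
  ∀ (E₀ : EuclideanSpace ℂ (Fin d)) (Ef : Field d P), IsFluctuatingField P R σ₁ σ₂ E₀ Ef →
    mean P (conductivity P R σ₁ σ₂ (constField P d E₀ + Ef)) = S.mulVec (fun i => E₀ i)

/-- The bounded operator `X₁ Γ X₁` on random vector fields. -/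
def bfM : Field d P →L[ℂ] Field d P := (X₁ P R).comp ((Gam d P).comp (X₁ P R))

/-! ### The Sobolev-type formulation -/

/-- Potentials `ξ·x + f`, the sum of a linear potential `ξ·x` (represented by the vector `ξ`) and
of a potential `f` of a fluctuating field. -/
abbrev Potential (d : ℕ) {Ω : Type*} [MeasurableSpace Ω] (P : Measure Ω) [IsFiniteMeasure P]
    [AddAction (EuclideanSpace ℝ (Fin d)) Ω] [MeasurableConstVAdd (EuclideanSpace ℝ (Fin d)) Ω]
    [VAddInvariantMeasure (EuclideanSpace ℝ (Fin d)) Ω P] : Type _ :=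
  EuclideanSpace ℂ (Fin d) × Sobolev d P

/-- The gradient `∇(ξ·x + f) = ξ + ∇f` of a potential. -/
def gradPotential (d : ℕ) {Ω : Type*} [MeasurableSpace Ω] (P : Measure Ω) [IsFiniteMeasure P]
    [AddAction (EuclideanSpace ℝ (Fin d)) Ω] [MeasurableConstVAdd (EuclideanSpace ℝ (Fin d)) Ω]
    [VAddInvariantMeasure (EuclideanSpace ℝ (Fin d)) Ω P] : Potential d P →ₗ[ℂ] Field d P :=
  ((constField P d).coprod (grad d P)).toLinearMap

/-- The map `f ↦ X₁ ∇f` on potentials. -/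
def X₁gradPotential : Potential d P →ₗ[ℂ] Field d P :=
  (X₁ P R).toLinearMap ∘ₗ gradPotential d P

/-- The Hilbert space of potentials with inner product `⟨f, g⟩ = ⟨X₁∇f, ∇g⟩ = ⟨X₁∇f, X₁∇g⟩`
(potentials with `X₁∇f = 0` being identified with `0`). -/
abbrev SobolevX₁ : Type _ := Energy (X₁gradPotential P R)

/-- The map `f ↦ X₁ ∇f`, extended by continuity to the Hilbert space of potentials. -/
def X₁grad : SobolevX₁ P R →L[ℂ] Field d P :=
  energyLift (X₁gradPotential P R) (X₁gradPotential P R) 1 (fun v => by rw [one_mul])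

/-- The map `f ↦ (∇*∇)⁻¹∇*X₁∇f` on potentials. -/
def preM : Potential d P →ₗ[ℂ] Potential d P :=
  LinearMap.inr ℂ (EuclideanSpace ℂ (Fin d)) (Sobolev d P) ∘ₗ
    (invLaplaceDiv d P).toLinearMap ∘ₗ (X₁ P R).toLinearMap ∘ₗ gradPotential d P

theorem norm_toEnergy_preM_le (v : Potential d P) :
    ‖(toEnergy (X₁gradPotential P R) ∘ₗ preM P R) v‖ ≤
      ‖(X₁ P R).comp (Gam d P)‖ * ‖X₁gradPotential P R v‖ := by
  have h : ‖toEnergy (X₁gradPotential P R) (preM P R v)‖ =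
      ‖X₁gradPotential P R (preM P R v)‖ := by
    rw [norm_eq_sqrt_re_inner (𝕜 := ℂ), inner_toEnergy, ← norm_eq_sqrt_re_inner]
  have h2 : X₁gradPotential P R (preM P R v) =
      ((X₁ P R).comp (Gam d P)) (X₁gradPotential P R v) := by
    simp [X₁gradPotential, preM, gradPotential, Gam]
  rw [LinearMap.comp_apply, h, h2]
  exact ContinuousLinearMap.le_opNorm _ _

/-- The operator `M = (∇*∇)⁻¹∇*X₁∇` on the Hilbert space of potentials. -/
def opM : SobolevX₁ P R →L[ℂ] SobolevX₁ P R :=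
  energyLift (X₁gradPotential P R) (toEnergy (X₁gradPotential P R) ∘ₗ preM P R)
    ‖(X₁ P R).comp (Gam d P)‖ (norm_toEnergy_preM_le P R)

/-- On potentials, `M` acts by `M f = (∇*∇)⁻¹∇*X₁∇f`. -/
theorem opM_toEnergy (f : Potential d P) :
    opM P R (toEnergy (X₁gradPotential P R) f) =
      toEnergy (X₁gradPotential P R) (0, invLaplaceDiv d P (X₁ P R (gradPotential d P f))) :=
  energyLift_toEnergy _ _ _ _ f

/-- The linear potential `φ₀ = E₀·x`, with `E₀ = a e_j`. -/
def phi₀ (d : ℕ) {Ω : Type*} [MeasurableSpace Ω] (P : Measure Ω) [IsFiniteMeasure P]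
    [AddAction (EuclideanSpace ℝ (Fin d)) Ω] [MeasurableConstVAdd (EuclideanSpace ℝ (Fin d)) Ω]
    [VAddInvariantMeasure (EuclideanSpace ℝ (Fin d)) Ω P] (j : Fin d) (a : ℂ) : Potential d P :=
  (EuclideanSpace.single j a, 0)

end Fields

end

end UniaxialComposite

open UniaxialComposite

namespace UniaxialComposite

noncomputable section

/-! ### Spectral resolution of a bounded self-adjoint operator -/

section Spectral

variable {H : Type*} [NormedAddCommGroup H] [InnerProductSpace ℂ H] [CompleteSpace H]

/-! The argument has three ingredients.

Hilbert space theory. The map `X₁grad` is an isometry, and X₁∇(M f) = X₁ΓX₁(X₁∇f), so it intertwines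
M with 𝐌 = X₁ΓX₁, which is self-adjoint because X₁ and Γ are orthogonal projections. Hence M is
self-adjoint. If V is the isometry, VV* commutes with 𝐌 and therefore with each Q(t), so V*Q(t)V is
a resolution of the identity for M. By uniqueness it is the only one
(`IsResolutionOfIdentity.intertwining`). Both measures are thus the spectral measure of 𝐌 at X₁e_j,
which lives on [0,1] because ⟨x, 𝐌x⟩ = ‖ΓX₁x‖².

The spectral theorem in projection form. The projection for (-∞, t] is the one onto ker (T - t)₊. It
is the strong limit of continuous functions of T, so its quadratic form is the distribution function
of the Riesz measure of f ↦ ⟨y, f(T)y⟩. Uniqueness holds because any resolution commutes with T, and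
ranges of competing projections are separated by comparing ⟨y, Ty⟩ with t‖y‖².

Analysis. The field problem is posed on weakly curl-free fields, whereas 𝐌 involves the projection Γ
onto gradients. These spaces agree (`mem_curlFree_iff`): a curl-free field orthogonal to gradients
is, after mollification along the group, both curl- and divergence-free in the strong sense, so all
its derivatives vanish, and ergodicity with mean zero makes it 0.

Since σ = σ₂(1 - s⁻¹X₁) and Γ kills constants, the field equation becomes E = s⁻¹ΓX₁(e + E). It is
solved by E = ΓS X₁e, where S is the resolvent of 𝐌 at s. The mean current is then σ₂(e - ⟨S X₁e⟩),
and the diagonal entries of S are integrals of 1/(s - λ) against the spectral measure. -/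

theorem isStarProjection_apply_apply {p : H →L[ℂ] H} (hp : IsStarProjection p) (x : H) :
    p (p x) = p x :=
  congrArg (fun q : H →L[ℂ] H => q x) hp.isIdempotentElem

theorem inner_apply_left_of_isSelfAdjoint {p : H →L[ℂ] H} (hp : IsSelfAdjoint p) (x y : H) :
    inner ℂ (p x) y = inner ℂ x (p y) :=
  hp.isSymmetric x y

theorem inner_self_apply_of_isStarProjection {p : H →L[ℂ] H} (hp : IsStarProjection p) (x : H) :
    inner ℂ x (p x) = ((‖p x‖ ^ 2 : ℝ) : ℂ) := by
  rw [← isStarProjection_apply_apply hp, ← inner_apply_left_of_isSelfAdjoint hp.isSelfAdjoint,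
    isStarProjection_apply_apply hp, inner_self_eq_norm_sq_to_K]
  norm_cast

theorem norm_sq_eq_add_of_isStarProjection {p : H →L[ℂ] H} (hp : IsStarProjection p) (x : H) :
    ‖x‖ ^ 2 = ‖p x‖ ^ 2 + ‖x - p x‖ ^ 2 := by
  have h : inner ℂ (p x) (x - p x) = 0 := by
    rw [inner_apply_left_of_isSelfAdjoint hp.isSelfAdjoint, map_sub,
      isStarProjection_apply_apply hp, sub_self, inner_zero_right]
  have := norm_add_sq_eq_norm_sq_add_norm_sq_of_inner_eq_zero (𝕜 := ℂ) _ _ h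
  rw [add_sub_cancel] at this
  rw [sq, sq, sq, this]

/-- Riesz–Markov–Kakutani for the functional f ↦ Re ⟨y, f(T)y⟩ on the compact spectrum, which is
positive because f ≥ 0 gives f(T) ≥ 0. Pushing the measure forward to ℝ leaves no mass off the
spectrum. -/
theorem exists_spectralMeasure {T : H →L[ℂ] H} (hT : IsSelfAdjoint T) (y : H) :
    ∃ μ : Measure ℝ, IsFiniteMeasure μ ∧ μ (spectrum ℝ T)ᶜ = 0 ∧
      ∀ f : ℝ → ℝ, ContinuousOn f (spectrum ℝ T) →
        ∫ t, f t ∂μ = (inner ℂ y (cfc f T y)).re := by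
  have hK : IsCompact (spectrum ℝ T) := ContinuousFunctionalCalculus.isCompact_spectrum T
  have : CompactSpace (spectrum ℝ T) := isCompact_iff_compactSpace.1 hK
  let L : CompactlySupportedContinuousMap (spectrum ℝ T) ℝ →ₗ[ℝ] ℝ :=
    { toFun := fun f => (inner ℂ y (cfcHom hT (f : C(spectrum ℝ T, ℝ)) y)).re
      map_add' := fun f g => by
        have : ((f + g : CompactlySupportedContinuousMap (spectrum ℝ T) ℝ) : C(spectrum ℝ T, ℝ)) =
          (f : C(spectrum ℝ T, ℝ)) + (g : C(spectrum ℝ T, ℝ)) := rfl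
        rw [this, map_add, add_apply, inner_add_right, Complex.add_re]
      map_smul' := fun c f => by
        have : ((c • f : CompactlySupportedContinuousMap (spectrum ℝ T) ℝ) : C(spectrum ℝ T, ℝ)) =
          c • (f : C(spectrum ℝ T, ℝ)) := rfl
        rw [this, map_smul, smul_apply, inner_smul_right_eq_smul, Complex.smul_re]
        rfl }
  let Λ : CompactlySupportedContinuousMap (spectrum ℝ T) ℝ →ₚ[ℝ] ℝ :=
    PositiveLinearMap.mk₀ L fun f hf => by
      have h : 0 ≤ cfcHom hT (f : C(spectrum ℝ T, ℝ)) := (cfcHom_nonneg_iff hT).2 fun x => hf x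
      exact ((ContinuousLinearMap.nonneg_iff_isPositive _).1 h).re_inner_nonneg_right y
  have hfin : IsFiniteMeasure (RealRMK.rieszMeasure Λ) := ⟨by
    have := (isCompact_univ (X := spectrum ℝ T)).measure_lt_top (μ := RealRMK.rieszMeasure Λ)
    exact this⟩
  have hemb : MeasurableEmbedding (Subtype.val : spectrum ℝ T → ℝ) :=
    MeasurableEmbedding.subtype_coe hK.measurableSet
  refine ⟨(RealRMK.rieszMeasure Λ).map Subtype.val, inferInstance, ?_, fun f hf => ?_⟩
  · rw [hemb.map_apply]
    convert measure_empty (μ := RealRMK.rieszMeasure Λ)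
    ext x
    simp
  · rw [hemb.integral_map, cfc_apply f T hT hf]
    exact RealRMK.integral_rieszMeasure Λ
      (CompactlySupportedContinuousMap.continuousMapEquiv ⟨_, hf.domRestrict⟩)

theorem norm_cfc_apply_sq {T : H →L[ℂ] H} {f : ℝ → ℝ}
    (hf : ContinuousOn f (spectrum ℝ T)) (y : H) :
    ‖cfc f T y‖ ^ 2 = (inner ℂ y (cfc (fun x => f x * f x) T y)).re := by
  have hs : IsSelfAdjoint (cfc f T) := cfc_predicate f T
  rw [cfc_mul f f T, mul_apply_eq_comp, ← inner_apply_left_of_isSelfAdjoint hs,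
    inner_self_eq_norm_sq_to_K]
  norm_cast

/-- From f² ≤ g² one gets f(T)² ≤ g(T)² as quadratic forms. This turns pointwise inequalities
between functions into inclusions between kernels. -/
theorem norm_cfc_apply_le {T : H →L[ℂ] H} {f g : ℝ → ℝ}
    (hf : ContinuousOn f (spectrum ℝ T)) (hg : ContinuousOn g (spectrum ℝ T))
    (h : ∀ x, |f x| ≤ |g x|) (y : H) : ‖cfc f T y‖ ≤ ‖cfc g T y‖ := by
  refine le_of_sq_le_sq ?_ (norm_nonneg _)
  rw [norm_cfc_apply_sq hf, norm_cfc_apply_sq hg]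
  have h1 : cfc (fun x => f x * f x) T ≤ cfc (fun x => g x * g x) T :=
    cfc_mono (fun x _ => by rw [← sq, ← sq]; exact sq_le_sq.2 (h x))
      (hf := hf.mul hf) (hg := hg.mul hg)
  have h2 := ((ContinuousLinearMap.le_def _ _).1 h1).re_inner_nonneg_right y
  rw [sub_apply, inner_sub_right, map_sub] at h2
  exact sub_nonneg.1 h2

/-- The positive part of `T - t`. -/
def posPartAt (T : H →L[ℂ] H) (t : ℝ) : H →L[ℂ] H := cfc (fun x : ℝ => max (x - t) 0) T

/-- The spectral projection of `T` for `(-∞, t]`: the orthogonal projection onto the kernel of the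
positive part of `T - t`. -/
def spectralProjection (T : H →L[ℂ] H) (t : ℝ) : H →L[ℂ] H :=
  (posPartAt T t).ker.starProjection

theorem isStarProjection_spectralProjection (T : H →L[ℂ] H) (t : ℝ) :
    IsStarProjection (spectralProjection T t) :=
  isStarProjection_starProjection

theorem spectralProjection_apply_eq_self_iff {T : H →L[ℂ] H} {t : ℝ} {x : H} :
    spectralProjection T t x = x ↔ posPartAt T t x = 0 :=
  Submodule.starProjection_eq_self_iff

theorem posPartAt_spectralProjection_apply (T : H →L[ℂ] H) (t : ℝ) (x : H) :
    posPartAt T t (spectralProjection T t x) = 0 :=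
  (posPartAt T t).ker.starProjection_apply_mem x

/-- Self-adjointness of T makes A* commute with T as well. So ker (T - t)₊ is invariant under both A
and A*, that is, it reduces A. -/
theorem spectralProjection_apply_commute {T A : H →L[ℂ] H} (hT : IsSelfAdjoint T)
    (hA : Commute T A) (t : ℝ) (x : H) :
    spectralProjection T t (A x) = A (spectralProjection T t x) := by
  have h1 : Commute (posPartAt T t) A := hA.cfc_real _
  have h2 : Commute (posPartAt T t) (star A) := Commute.cfc_real
    (by simpa [hT.star_eq] using hA.star_star) _
  refine Submodule.eq_starProjection_of_mem_of_inner_eq_zero ?_ fun w hw => ?_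
  · change posPartAt T t (A _) = 0
    rw [← mul_apply_eq_comp, h1.eq, mul_apply_eq_comp,
      posPartAt_spectralProjection_apply, map_zero]
  · have hw' : posPartAt T t w = 0 := hw
    have h3 : star A w ∈ (posPartAt T t).ker := by
      change posPartAt T t (star A w) = 0
      rw [← mul_apply_eq_comp, h2.eq, mul_apply_eq_comp, hw', map_zero]
    rw [← map_sub, ← ContinuousLinearMap.adjoint_inner_right]
    exact Submodule.starProjection_inner_eq_zero x _ h3

/-- A continuous piecewise linear approximation, from above, to the indicator function of
`(-∞, t]`. -/
def ramp (t : ℝ) (n : ℕ) (x : ℝ) : ℝ := max 0 (1 - (n + 1) * max (x - t) 0)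

theorem continuous_ramp (t : ℝ) (n : ℕ) : Continuous (ramp t n) := by
  unfold ramp; fun_prop

theorem abs_ramp_le (t : ℝ) (n : ℕ) (x : ℝ) : |ramp t n x| ≤ 1 := by
  have h : 0 ≤ (n + 1) * max (x - t) 0 := by positivity
  rw [ramp, abs_of_nonneg (le_max_left _ _)]
  exact max_le zero_le_one (by linarith)

theorem tendsto_ramp (t x : ℝ) :
    Tendsto (fun n => ramp t n x) atTop (𝓝 ((Set.Iic t).indicator 1 x)) := by
  by_cases hx : x ≤ t
  · have h : ∀ n, ramp t n x = 1 := fun n => by simp [ramp, max_eq_right (sub_nonpos.2 hx)]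
    simp [h, hx]
  · rw [Set.indicator_of_notMem (by simpa using hx)]
    have hx' : 0 < x - t := by linarith
    refine tendsto_const_nhds.congr' ?_
    obtain ⟨N, hN⟩ := exists_nat_gt (x - t)⁻¹
    filter_upwards [eventually_ge_atTop N] with n hn
    have h1 : (N : ℝ) ≤ n := by exact_mod_cast hn
    have h2 : 1 ≤ (n + 1) * (x - t) := by
      have h3 : (x - t)⁻¹ * (x - t) ≤ (n + 1) * (x - t) := by gcongr; linarith
      rwa [inv_mul_cancel₀ hx'.ne'] at h3
    rw [ramp, max_eq_left hx'.le, max_eq_left (by linarith)]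

/-- Pointwise 0 ≤ 1 - ramp ≤ (n + 1)(s - t)₊, so whatever (T - t)₊ kills is also killed by 1 -
ramp(T). -/
theorem cfc_ramp_apply_of_posPartAt_eq_zero {T : H →L[ℂ] H} (hT : IsSelfAdjoint T) {t : ℝ} {x : H}
    (hx : posPartAt T t x = 0) (n : ℕ) : cfc (ramp t n) T x = x := by
  have hc := continuous_ramp t n
  have h1 : ‖cfc (fun s => 1 - ramp t n s) T x‖ ≤ ‖cfc (fun s => (n + 1 : ℝ) * max (s - t) 0) T x‖ := by
    refine norm_cfc_apply_le (by fun_prop) (by fun_prop) (fun s => ?_) x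
    have h : 0 ≤ (n + 1) * max (s - t) 0 := by positivity
    rw [abs_of_nonneg h, abs_of_nonneg (by linarith [le_of_abs_le (abs_ramp_le t n s)]), ramp]
    linarith [le_max_right 0 (1 - (n + 1) * max (s - t) 0)]
  rw [cfc_const_mul (n + 1 : ℝ) (fun s => max (s - t) 0) T, smul_apply] at h1
  change _ ≤ ‖(n + 1 : ℝ) • posPartAt T t x‖ at h1
  rw [hx, smul_zero, norm_zero, cfc_sub (fun _ => (1 : ℝ)) (ramp t n) T, cfc_const_one ℝ T,
    sub_apply, norm_le_zero_iff] at h1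
  exact (sub_eq_zero.1 h1).symm

/-- The ramp is at most 1 and vanishes as soon as (s - t)₊ ≥ 1/(n + 1). -/
theorem norm_cfc_ramp_mul_posPartAt_le (T : H →L[ℂ] H) (t : ℝ) (n : ℕ) :
    ‖cfc (ramp t n) T * posPartAt T t‖ ≤ 1 / ((n : ℝ) + 1) := by
  have hc := continuous_ramp t n
  rw [posPartAt, ← cfc_mul (ramp t n) (fun s => max (s - t) 0) T]
  refine norm_cfc_le (by positivity) fun s _ => ?_
  have hu : 0 ≤ max (s - t) 0 := le_max_right _ _
  have hr := abs_ramp_le t n s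
  rw [Real.norm_eq_abs, abs_mul, abs_of_nonneg hu, le_div_iff₀ (by positivity)]
  rcases le_total (1 - (n + 1) * max (s - t) 0) 0 with h | h
  · simp [ramp, max_eq_left h]
  · nlinarith [mul_nonneg (abs_nonneg (ramp t n s)) h]

/-- Decompose x along ker (T - t)₊ and its orthogonal complement, the closure of the range of (T -
t)₊. The ramps act as the identity on the kernel, tend to 0 on the range, and are bounded by 1
uniformly, which handles the closure. -/
theorem tendsto_cfc_ramp_apply {T : H →L[ℂ] H} (hT : IsSelfAdjoint T) (t : ℝ) (x : H) :
    Tendsto (fun n => cfc (ramp t n) T x) atTop (𝓝 (spectralProjection T t x)) := by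
  set p := spectralProjection T t x with hp
  have hmem : x - p ∈ (posPartAt T t).range.topologicalClosure := by
    have h1 : x - p ∈ (posPartAt T t).kerᗮ := Submodule.sub_starProjection_mem_orthogonal x
    have hs : IsSelfAdjoint (posPartAt T t) := cfc_predicate _ T
    rwa [ContinuousLinearMap.orthogonal_ker, hs.adjoint_eq] at h1
  have h0 : Tendsto (fun n => cfc (ramp t n) T (x - p)) atTop (𝓝 0) := by
    rw [Metric.tendsto_atTop]
    intro ε hε
    obtain ⟨_, ⟨z, rfl⟩, hz⟩ := Metric.mem_closure_iff.1 hmem (ε / 2) (by positivity)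
    obtain ⟨N, hN⟩ := exists_nat_gt (‖z‖ / (ε / 2))
    refine ⟨N, fun n hn => ?_⟩
    have hb : ‖cfc (ramp t n) T‖ ≤ 1 := norm_cfc_le zero_le_one fun s _ => abs_ramp_le t n s
    have h1 : ‖cfc (ramp t n) T (x - p - posPartAt T t z)‖ ≤ dist (x - p) (posPartAt T t z) := by
      rw [dist_eq_norm]
      exact (ContinuousLinearMap.le_of_opNorm_le _ hb _).trans (by rw [one_mul])
    have h2 : ‖cfc (ramp t n) T (posPartAt T t z)‖ ≤ 1 / ((n : ℝ) + 1) * ‖z‖ :=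
      ContinuousLinearMap.le_of_opNorm_le _ (norm_cfc_ramp_mul_posPartAt_le T t n) z
    have h3 : 1 / ((n : ℝ) + 1) * ‖z‖ < ε / 2 := by
      have h4 : (N : ℝ) ≤ n := by exact_mod_cast hn
      rw [div_lt_iff₀ (by positivity)] at hN
      rw [div_mul_eq_mul_div, one_mul, div_lt_iff₀ (by positivity)]
      nlinarith
    rw [dist_zero_right, ← sub_add_cancel (x - p) (posPartAt T t z), map_add]
    exact (norm_add_le _ _).trans_lt (by simp only [ContinuousLinearMap.coe_coe] at hz; linarith)
  have h1 : ∀ n, cfc (ramp t n) T x = p + cfc (ramp t n) T (x - p) := fun n => by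
    rw [map_sub, cfc_ramp_apply_of_posPartAt_eq_zero hT (x := p)
      (posPartAt_spectralProjection_apply T t x), add_sub_cancel]
  simp_rw [h1]
  simpa using h0.const_add p

/-- The measure `⟨y, E(·) y⟩` of the spectral measure `E` of a self-adjoint operator. -/
theorem exists_measure_Iic_eq_spectralProjection {T : H →L[ℂ] H} (hT : IsSelfAdjoint T) (y : H) :
    ∃ μ : Measure ℝ, IsFiniteMeasure μ ∧ μ (spectrum ℝ T)ᶜ = 0 ∧
      (∀ f : ℝ → ℝ, ContinuousOn f (spectrum ℝ T) →
        ∫ t, f t ∂μ = (inner ℂ y (cfc f T y)).re) ∧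
      ∀ t, μ.real (Set.Iic t) = ‖spectralProjection T t y‖ ^ 2 := by
  obtain ⟨μ, hfin, hsupp, hμ⟩ := exists_spectralMeasure hT y
  refine ⟨μ, hfin, hsupp, hμ, fun t => ?_⟩
  -- The integrals of the ramps have two limits to compare: the mass of (-∞, t] by dominated
  -- convergence, and the form of the projection by strong convergence.
  have h1 : Tendsto (fun n => ∫ x, ramp t n x ∂μ) atTop
      (𝓝 (∫ x, (Set.Iic t).indicator (1 : ℝ → ℝ) x ∂μ)) := by
    refine tendsto_integral_of_dominated_convergence (fun _ => 1)
      (fun n => (continuous_ramp t n).aestronglyMeasurable) (integrable_const _)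
      (fun n => Eventually.of_forall fun x => abs_ramp_le t n x)
      (Eventually.of_forall fun x => tendsto_ramp t x)
  have h2 : Tendsto (fun n => ∫ x, ramp t n x ∂μ) atTop
      (𝓝 (inner ℂ y (spectralProjection T t y)).re) := by
    simp_rw [fun n => hμ (ramp t n) (continuous_ramp t n).continuousOn]
    exact (Complex.continuous_re.tendsto _).comp
      (tendsto_const_nhds.inner (tendsto_cfc_ramp_apply hT t y))
  have h3 := tendsto_nhds_unique h1 h2
  rw [integral_indicator_one measurableSet_Iic,
    inner_self_apply_of_isStarProjection (isStarProjection_spectralProjection T t),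
    Complex.ofReal_re] at h3
  exact h3

theorem posPartAt_apply_eq_zero_of_le {T : H →L[ℂ] H} {t u : ℝ}
    (h : t ≤ u) {x : H} (hx : posPartAt T t x = 0) : posPartAt T u x = 0 := by
  rw [← norm_le_zero_iff]
  refine (norm_cfc_apply_le (g := fun x => max (x - t) 0) (by fun_prop) (by fun_prop)
    (fun s => ?_) x).trans_eq (by rw [← posPartAt, hx, norm_zero])
  rw [abs_of_nonneg (le_max_right _ _), abs_of_nonneg (le_max_right _ _)]
  gcongr

theorem spectralProjection_comp_of_le (T : H →L[ℂ] H) {t u : ℝ}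
    (h : t ≤ u) : (spectralProjection T t).comp (spectralProjection T u) =
      spectralProjection T t := by
  have h1 : (spectralProjection T u) * (spectralProjection T t) = spectralProjection T t := by
    ext x
    exact spectralProjection_apply_eq_self_iff.2
      (posPartAt_apply_eq_zero_of_le h (posPartAt_spectralProjection_apply T t x))
  have h2 := congrArg star h1
  rwa [star_mul, (isStarProjection_spectralProjection T t).isSelfAdjoint.star_eq,
    (isStarProjection_spectralProjection T u).isSelfAdjoint.star_eq] at h2

/-- Pythagoras for nested projections. It reduces strong continuity of the resolution to one-sided
continuity of the distribution function. -/
theorem norm_sub_sq_of_isStarProjection {p q : H →L[ℂ] H} (hp : IsStarProjection p)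
    (h : p.comp q = p) (x : H) :
    ‖q x - p x‖ ^ 2 = ‖q x‖ ^ 2 - ‖p x‖ ^ 2 := by
  have h1 := norm_sq_eq_add_of_isStarProjection hp (q x)
  have h2 : p (q x) = p x := congrArg (fun q : H →L[ℂ] H => q x) h
  rw [h2] at h1
  linarith

theorem tendsto_of_norm_sq_sub_tendsto {E ι : Type*} [SeminormedAddCommGroup E] {l : Filter ι}
    {f : ι → E} {a : E}
    (h : Tendsto (fun i => ‖f i - a‖ ^ 2) l (𝓝 0)) : Tendsto f l (𝓝 a) := by
  rw [tendsto_iff_norm_sub_tendsto_zero]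
  have := h.sqrt
  simpa using this

theorem tendsto_measureReal_Iic_nhdsGT (μ : Measure ℝ) [IsFiniteMeasure μ] (t : ℝ) :
    Tendsto (fun u => μ.real (Set.Iic u)) (𝓝[>] t) (𝓝 (μ.real (Set.Iic t))) := by
  have h := tendsto_measure_biInter_gt (μ := μ) (s := Set.Iic) (a := t)
    (fun _ _ => measurableSet_Iic.nullMeasurableSet) (fun _ _ _ h => Set.Iic_subset_Iic.2 h)
    ⟨t + 1, by simp, measure_ne_top _ _⟩
  rw [show ⋂ r > t, Set.Iic r = Set.Iic t by
    ext x; simpa using ⟨fun h => le_of_forall_gt_imp_ge_of_dense h, fun h i hi => h.trans hi.le⟩] at h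
  exact (ENNReal.tendsto_toReal (measure_ne_top _ _)).comp h

theorem tendsto_measureReal_Iic_atTop (μ : Measure ℝ) [IsFiniteMeasure μ] :
    Tendsto (fun u => μ.real (Set.Iic u)) atTop (𝓝 (μ.real Set.univ)) :=
  (ENNReal.tendsto_toReal (measure_ne_top _ _)).comp (tendsto_measure_Iic_atTop μ)

theorem tendsto_measureReal_Iic_atBot (μ : Measure ℝ) [IsFiniteMeasure μ] :
    Tendsto (fun u => μ.real (Set.Iic u)) atBot (𝓝 0) := by
  have h := tendsto_measure_iInter_atBot (μ := μ) (s := Set.Iic)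
    (fun _ => measurableSet_Iic.nullMeasurableSet) (fun _ _ h => Set.Iic_subset_Iic.2 h)
    ⟨0, measure_ne_top _ _⟩
  rw [show ⋂ r : ℝ, Set.Iic r = ∅ by ext x; simpa using ⟨x - 1, by simp⟩, measure_empty] at h
  exact (ENNReal.tendsto_toReal ENNReal.zero_ne_top).comp h

/-- **Spectral theorem**: a bounded self-adjoint operator has a resolution of the identity. -/
theorem isResolutionOfIdentity_spectralProjection {T : H →L[ℂ] H} (hT : IsSelfAdjoint T) :
    IsResolutionOfIdentity T (spectralProjection T) where
  isStarProjection := isStarProjection_spectralProjection T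
  comp_of_le _ _ h := spectralProjection_comp_of_le T h
  tendsto_right t x := by
    obtain ⟨μ, hfin, -, -, hμ⟩ := exists_measure_Iic_eq_spectralProjection hT x
    refine tendsto_of_norm_sq_sub_tendsto ?_
    have h1 : Tendsto (fun u => μ.real (Set.Iic u)) (𝓝[>] t) (𝓝 (μ.real (Set.Iic t))) :=
      tendsto_measureReal_Iic_nhdsGT μ t
    have h2 : Tendsto (fun u => μ.real (Set.Iic u) - μ.real (Set.Iic t)) (𝓝[>] t) (𝓝 0) := by
      simpa using h1.sub_const (μ.real (Set.Iic t))
    refine h2.congr' ?_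
    filter_upwards [self_mem_nhdsWithin] with u hu
    rw [hμ, hμ, norm_sub_sq_of_isStarProjection (isStarProjection_spectralProjection T t)
      (spectralProjection_comp_of_le T (le_of_lt hu))]
  tendsto_atBot x := by
    obtain ⟨μ, hfin, -, -, hμ⟩ := exists_measure_Iic_eq_spectralProjection hT x
    refine tendsto_of_norm_sq_sub_tendsto ?_
    simp_rw [sub_zero, ← hμ]
    exact tendsto_measureReal_Iic_atBot μ
  tendsto_atTop x := by
    obtain ⟨μ, hfin, -, hint, hμ⟩ := exists_measure_Iic_eq_spectralProjection hT x
    refine tendsto_of_norm_sq_sub_tendsto ?_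
    have huniv : μ.real Set.univ = ‖x‖ ^ 2 := by
      have := hint (fun _ => 1) (by fun_prop)
      rw [cfc_const_one ℝ T, one_apply_eq_self, inner_self_eq_norm_sq_to_K] at this
      simp at this
      norm_cast at this
    have h1 : Tendsto (fun u => μ.real (Set.Iic u)) atTop (𝓝 (μ.real Set.univ)) :=
      tendsto_measureReal_Iic_atTop μ
    have h2 : Tendsto (fun u => μ.real Set.univ - μ.real (Set.Iic u)) atTop (𝓝 0) := by
      simpa using h1.const_sub (μ.real Set.univ)
    refine h2.congr fun u => ?_
    rw [hμ, huniv, norm_sub_rev, norm_sq_eq_add_of_isStarProjection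
      (isStarProjection_spectralProjection T u) x, add_sub_cancel_left]
  integral_eq x := by
    obtain ⟨μ, hfin, hsupp, hint, hμ⟩ := exists_measure_Iic_eq_spectralProjection hT x
    refine ⟨μ, ⟨hfin, fun t => ?_⟩, ?_, ?_⟩
    · rw [hμ, inner_self_apply_of_isStarProjection (isStarProjection_spectralProjection T t)]
    · rw [← Measure.restrict_eq_self_of_ae_mem (show ∀ᵐ t ∂μ, t ∈ spectrum ℝ T from hsupp)]
      exact continuousOn_id.integrableOn_compact
        (ContinuousFunctionalCalculus.isCompact_spectrum T)
    · rw [hint (fun t => t) (by fun_prop), cfc_id' ℝ T]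
      exact hT.isSymmetric.coe_re_inner_self_apply x

/-! ### Uniqueness of the resolution of the identity -/

namespace IsResolutionOfIdentity

variable {T : H →L[ℂ] H} {Q : ℝ → H →L[ℂ] H}

theorem apply_apply_of_le (h : IsResolutionOfIdentity T Q) {t u : ℝ} (htu : t ≤ u) (x : H) :
    Q t (Q u x) = Q t x :=
  congrArg (fun q : H →L[ℂ] H => q x) (h.comp_of_le t u htu)

theorem apply_apply_of_ge (h : IsResolutionOfIdentity T Q) {t u : ℝ} (htu : t ≤ u) (x : H) :
    Q u (Q t x) = Q t x := by
  have h2 := congrArg star (h.comp_of_le t u htu)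
  rw [← ContinuousLinearMap.mul_def, star_mul, (h.isStarProjection t).isSelfAdjoint.star_eq,
    (h.isStarProjection u).isSelfAdjoint.star_eq] at h2
  exact congrArg (fun q : H →L[ℂ] H => q x) h2

theorem apply_comm (h : IsResolutionOfIdentity T Q) (t u : ℝ) (x : H) :
    Q t (Q u x) = Q u (Q t x) := by
  rcases le_total t u with htu | htu
  · rw [h.apply_apply_of_le htu, h.apply_apply_of_ge htu]
  · rw [h.apply_apply_of_le htu, h.apply_apply_of_ge htu]

theorem exists_measure (h : IsResolutionOfIdentity T Q) (x : H) :
    ∃ μ : Measure ℝ, IsFiniteMeasure μ ∧ (∀ t, μ.real (Set.Iic t) = ‖Q t x‖ ^ 2) ∧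
      μ.real Set.univ = ‖x‖ ^ 2 ∧ Integrable (fun t : ℝ => t) μ ∧
      ∫ t, t ∂μ = (inner ℂ x (T x)).re := by
  obtain ⟨μ, ⟨hfin, hμ⟩, hint, hT⟩ := h.integral_eq x
  have h1 : ∀ t, μ.real (Set.Iic t) = ‖Q t x‖ ^ 2 := fun t => by
    have := hμ t
    rw [inner_self_apply_of_isStarProjection (h.isStarProjection t)] at this
    exact_mod_cast this.symm
  refine ⟨μ, hfin, h1, ?_, hint, by rw [← hT, Complex.ofReal_re]⟩
  refine tendsto_nhds_unique (tendsto_measureReal_Iic_atTop μ) ?_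
  simp_rw [h1]
  exact (h.tendsto_atTop x).norm.pow 2

/-- The measure of such an x is concentrated on (-∞, t]. Together with the strict opposite bound on
ker Q(t), this is what forces two resolutions to agree. -/
theorem re_inner_le_of_apply_eq_self (h : IsResolutionOfIdentity T Q) {t : ℝ} {x : H}
    (hx : Q t x = x) : (inner ℂ x (T x)).re ≤ t * ‖x‖ ^ 2 := by
  obtain ⟨μ, hfin, hμ, huniv, hint, hT⟩ := h.exists_measure x
  have h0 : ∀ᵐ s ∂μ, s ≤ t := by
    change μ (Set.Iic t)ᶜ = 0
    rw [← measureReal_eq_zero_iff, measureReal_compl measurableSet_Iic, hμ, huniv, hx, sub_self]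
  rw [← hT, ← huniv, mul_comm, ← smul_eq_mul, ← integral_const]
  exact integral_mono_ae hint (integrable_const _) h0

theorem lt_re_inner_of_apply_eq_zero (h : IsResolutionOfIdentity T Q) {t : ℝ} {x : H}
    (hx : Q t x = 0) (hx0 : x ≠ 0) : t * ‖x‖ ^ 2 < (inner ℂ x (T x)).re := by
  obtain ⟨μ, hfin, hμ, huniv, hint, hT⟩ := h.exists_measure x
  have h0 : ∀ᵐ s ∂μ, t < s := by
    have : μ (Set.Iic t) = 0 := by rw [← measureReal_eq_zero_iff, hμ, hx]; simp
    rw [ae_iff]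
    simpa [Set.Iic] using this
  have hμ0 : 0 < μ.real Set.univ := by rw [huniv]; positivity
  have h1 : 0 < ∫ s, (s - t) ∂μ := by
    rw [integral_pos_iff_support_of_nonneg_ae (h0.mono fun s hs => (sub_pos.2 hs).le)
      (hint.sub (integrable_const _))]
    refine lt_of_lt_of_le ?_ (measure_mono_ae (s := Set.univ)
      (h0.mono fun s hs _ => (sub_pos.2 hs).ne'))
    exact (ENNReal.toReal_pos_iff.1 hμ0).1
  rw [integral_sub hint (integrable_const _), integral_const, smul_eq_mul, huniv, hT] at h1
  linarith

/-- The Q(u) commute with Q(t), so the measure of x is the sum of those of Q(t)x and x - Q(t)x.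
Integrating, the form of T has no cross terms, and over ℂ a form determines its operator: T = QTQ +
(1 - Q)T(1 - Q). -/
theorem commute (h : IsResolutionOfIdentity T Q) (t : ℝ) : Commute T (Q t) := by
  have hp := h.isStarProjection t
  have key : ∀ x, inner ℂ x (T x) = inner ℂ (Q t x) (T (Q t x)) +
      inner ℂ (x - Q t x) (T (x - Q t x)) := fun x => by
    obtain ⟨μ, ⟨hfin, hμ⟩, hint, hT⟩ := h.integral_eq x
    obtain ⟨μ₁, ⟨hfin₁, hμ₁⟩, hint₁, hT₁⟩ := h.integral_eq (Q t x)
    obtain ⟨μ₂, ⟨hfin₂, hμ₂⟩, hint₂, hT₂⟩ := h.integral_eq (x - Q t x)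
    have hμe : μ = μ₁ + μ₂ := by
      refine Measure.ext_of_Iic _ _ fun u => ?_
      rw [← measureReal_eq_measureReal_iff, measureReal_add_apply, ← Complex.ofReal_inj,
        Complex.ofReal_add, ← hμ, ← hμ₁, ← hμ₂, inner_sub_left, map_sub, inner_sub_right,
        inner_sub_right, inner_apply_left_of_isSelfAdjoint hp.isSelfAdjoint,
        inner_apply_left_of_isSelfAdjoint hp.isSelfAdjoint, h.apply_comm t u,
        h.apply_comm t u, isStarProjection_apply_apply hp]
      ring
    rw [← hT, ← hT₁, ← hT₂, hμe, integral_add_measure hint₁ hint₂, Complex.ofReal_add]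
  have hS : T - Q t * T * Q t - (1 - Q t) * T * (1 - Q t) = 0 := by
    rw [← ContinuousLinearMap.coe_inj]
    refine (inner_map_self_eq_zero _).1 fun x => ?_
    rw [ContinuousLinearMap.coe_coe, ← inner_conj_symm, map_eq_zero]
    simp only [sub_apply, mul_apply_eq_comp, one_apply_eq_self, inner_sub_right]
    rw [key x, inner_apply_left_of_isSelfAdjoint hp.isSelfAdjoint, inner_sub_left,
      inner_apply_left_of_isSelfAdjoint hp.isSelfAdjoint, map_sub, map_sub, inner_sub_right,
      inner_sub_right]
    ring
  have h1 : Q t * Q t = Q t := hp.isIdempotentElem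
  have h2 : T * Q t = Q t * T * Q t := by
    have := congrArg (· * Q t) hS
    simp only [sub_mul, mul_assoc, one_mul, h1, mul_sub, zero_mul, mul_one, sub_self, sub_zero] at this
    rw [mul_assoc]
    exact sub_eq_zero.1 this
  have h3 : Q t * T = Q t * T * Q t := by
    have := congrArg (Q t * ·) hS
    simp only [sub_mul, ← mul_assoc, one_mul, h1, mul_sub, mul_zero, mul_one, sub_self, sub_zero] at this
    exact sub_eq_zero.1 this
  exact h2.trans h3.symm

/-- A bounded self-adjoint operator has only one resolution of the identity. -/
theorem eq_spectralProjection (hT : IsSelfAdjoint T) (h : IsResolutionOfIdentity T Q) :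
    Q = spectralProjection T := by
  have h' := isResolutionOfIdentity_spectralProjection hT
  ext t x
  have hc := spectralProjection_apply_commute hT (h.commute t) t
  have hp := h.isStarProjection t
  have hp' := h'.isStarProjection t
  -- A nonzero vector y here would lie in the range of Q(t), so ⟨y, Ty⟩ ≤ t‖y‖². It would also be
  -- killed by the spectral projection, which commutes with Q(t), so ⟨y, Ty⟩ > t‖y‖². `h4` is the
  -- same with the roles exchanged.
  have h1 : Q t (x - spectralProjection T t x) = 0 := by
    by_contra hne
    have h2 := h.re_inner_le_of_apply_eq_self (isStarProjection_apply_apply hp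
      (x - spectralProjection T t x))
    have h3 := h'.lt_re_inner_of_apply_eq_zero (t := t) (by
      rw [hc, map_sub, isStarProjection_apply_apply hp', sub_self, map_zero]) hne
    linarith
  have h4 : spectralProjection T t (x - Q t x) = 0 := by
    by_contra hne
    have h2 := h'.re_inner_le_of_apply_eq_self (isStarProjection_apply_apply hp' (x - Q t x))
    have h3 := h.lt_re_inner_of_apply_eq_zero (t := t) (by
      rw [← hc, map_sub, isStarProjection_apply_apply hp, sub_self, map_zero]) hne
    linarith
  rw [map_sub, sub_eq_zero] at h1 h4
  rw [h4, hc]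
  exact h1

theorem unique (hT : IsSelfAdjoint T) {Q' : ℝ → H →L[ℂ] H} (h : IsResolutionOfIdentity T Q)
    (h' : IsResolutionOfIdentity T Q') : Q = Q' := by
  rw [h.eq_spectralProjection hT, h'.eq_spectralProjection hT]

end IsResolutionOfIdentity

theorem existsUnique_isResolutionOfIdentity {T : H →L[ℂ] H} (hT : IsSelfAdjoint T) :
    ∃! Q, IsResolutionOfIdentity T Q :=
  ⟨_, isResolutionOfIdentity_spectralProjection hT, fun _ h => h.eq_spectralProjection hT⟩

theorem IsStieltjesMeasure.unique {μ ν : Measure ℝ} {F : ℝ → ℂ} (hμ : IsStieltjesMeasure μ F)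
    (hν : IsStieltjesMeasure ν F) : μ = ν := by
  have := hμ.isFinite
  have := hν.isFinite
  refine Measure.ext_of_Iic _ _ fun t => ?_
  rw [← measureReal_eq_measureReal_iff, ← Complex.ofReal_inj, ← hμ.eq_measure_Iic,
    ← hν.eq_measure_Iic]

theorem IsStieltjesMeasure.spectral {T : H →L[ℂ] H} (hT : IsSelfAdjoint T)
    {Q : ℝ → H →L[ℂ] H} (h : IsResolutionOfIdentity T Q) {y : H} {μ : Measure ℝ}
    (hμ : IsStieltjesMeasure μ fun t => inner ℂ y (Q t y)) :
    μ (spectrum ℝ T)ᶜ = 0 ∧ ∀ f : ℝ → ℝ, ContinuousOn f (spectrum ℝ T) →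
      ∫ t, f t ∂μ = (inner ℂ y (cfc f T y)).re := by
  obtain ⟨ν, hfin, hsupp, hint, hν⟩ := exists_measure_Iic_eq_spectralProjection hT y
  have : μ = ν := hμ.unique ⟨hfin, fun t => by
    rw [h.eq_spectralProjection hT, hν,
      inner_self_apply_of_isStarProjection (isStarProjection_spectralProjection T t)]⟩
  exact this ▸ ⟨hsupp, hint⟩

/-- The functional calculus in use is real while s is complex, so the resolvent is assembled from
1/(s - t) = ((Re s - t) - i Im s)/N(t) with N(t) = |s - t|², which does not vanish on the spectrum.
-/
theorem integral_one_div_sub_eq_inner_resolvent {T : H →L[ℂ] H} (hT : IsSelfAdjoint T)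
    {Q : ℝ → H →L[ℂ] H} (h : IsResolutionOfIdentity T Q) {s : ℂ}
    (hs : ∀ t ∈ spectrum ℝ T, s ≠ (t : ℂ)) :
    ∃ S : H →L[ℂ] H, (s • 1 - T) * S = 1 ∧ S * (s • 1 - T) = 1 ∧
      ∀ (y : H) (μ : Measure ℝ), IsStieltjesMeasure μ (fun t => inner ℂ y (Q t y)) →
        ∫ t : ℝ, 1 / (s - t) ∂μ = inner ℂ y (S y) := by
  set D : H →L[ℂ] H := cfc (fun t : ℝ => s.re - t) T with hD
  have hDT : D = (s.re : ℂ) • 1 - T := by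
    rw [hD, cfc_sub (fun _ : ℝ => s.re) (fun t => t) T, cfc_const s.re T, cfc_id' ℝ T]
    rw [Algebra.algebraMap_eq_smul_one]
    rfl
  have hne : ∀ t ∈ spectrum ℝ T, (s.re - t) * (s.re - t) + s.im * s.im ≠ 0 := fun t ht h0 => by
    refine hs t ht (Complex.ext ?_ ?_)
    · rw [Complex.ofReal_re]; nlinarith
    · rw [Complex.ofReal_im]; nlinarith
  set N : ℝ → ℝ := fun t => (s.re - t) * (s.re - t) + s.im * s.im with hN
  have hNc : ContinuousOn N (spectrum ℝ T) := by fun_prop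
  have hwc : ContinuousOn (fun t => (N t)⁻¹) (spectrum ℝ T) := hNc.inv₀ hne
  set W : H →L[ℂ] H := cfc (fun t => (N t)⁻¹) T with hW
  set β : ℂ := s.im * Complex.I with hβ
  have hββ : β * β = -((s.im * s.im : ℝ) : ℂ) := by
    rw [hβ, mul_mul_mul_comm, Complex.I_mul_I]; push_cast; ring
  have hsβ : s = s.re + β := (Complex.re_add_im s).symm
  have hNop : cfc N T = D * D + ((s.im * s.im : ℝ) : ℂ) • 1 := by
    rw [hN, cfc_add (a := T) (fun t : ℝ => (s.re - t) * (s.re - t)) (fun _ => s.im * s.im),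
      cfc_mul (fun t : ℝ => s.re - t) (fun t : ℝ => s.re - t) T, cfc_const (s.im * s.im) T,
      Algebra.algebraMap_eq_smul_one]
    rfl
  have hNW : cfc N T * W = 1 := by
    rw [hW, ← cfc_mul N (fun t => (N t)⁻¹) T hNc hwc, ← cfc_const_one ℝ T]
    exact cfc_congr fun t ht => mul_inv_cancel₀ (hne t ht)
  have hDW : D * W = W * D := (cfc_commute_cfc _ _ T).eq
  have hsT : s • 1 - T = D + β • 1 := by
    rw [hDT, hsβ, add_smul]
    simp only [← hsβ]
    abel
  have hB : (β • 1 : H →L[ℂ] H) * (β • 1) = -(((s.im * s.im : ℝ) : ℂ) • 1) := by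
    rw [smul_mul_smul_comm, hββ, one_mul, neg_smul]
  have hBc : ∀ A : H →L[ℂ] H, (β • 1) * A = A * (β • 1) := fun A => by
    rw [smul_one_mul, mul_smul_one]
  have h1 : (D + β • 1) * (D - β • 1) = cfc N T := by
    rw [hNop, add_mul, mul_sub, mul_sub, hB, hBc D]
    abel
  have h2 : (D - β • 1) * (D + β • 1) = cfc N T := by
    rw [hNop, sub_mul, mul_add, mul_add, hB, hBc D]
    abel
  have h3 : (D - β • 1) * W = W * (D - β • 1) := by
    rw [sub_mul, mul_sub, hDW, hBc W]
  have hNW' : W * cfc N T = 1 := by rw [← hNW]; exact (cfc_commute_cfc _ _ T).eq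
  refine ⟨(D - β • 1) * W, ?_, ?_, fun y μ hμ => ?_⟩
  · rw [hsT, ← mul_assoc, h1, hNW]
  · rw [hsT, h3, mul_assoc, h2, hNW']
  · obtain ⟨hsupp, hint⟩ := hμ.spectral hT h
    have := hμ.isFinite
    have hK : IsCompact (spectrum ℝ T) := ContinuousFunctionalCalculus.isCompact_spectrum T
    have hintble : ∀ f : ℝ → ℝ, ContinuousOn f (spectrum ℝ T) → Integrable f μ := fun f hf => by
      rw [← Measure.restrict_eq_self_of_ae_mem (show ∀ᵐ t ∂μ, t ∈ spectrum ℝ T from hsupp)]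
      exact hf.integrableOn_compact hK
    have hintbleC : ∀ f : ℝ → ℝ, ContinuousOn f (spectrum ℝ T) →
        Integrable (fun t => (f t : ℂ)) μ := fun f hf => (hintble f hf).ofReal
    have hc1 : ContinuousOn (fun t => (s.re - t) * (N t)⁻¹) (spectrum ℝ T) :=
      ContinuousOn.mul (by fun_prop) hwc
    have hreal : ∀ f : ℝ → ℝ, ((inner ℂ y (cfc f T y)).re : ℂ) = inner ℂ y (cfc f T y) := fun f =>
      (cfc_predicate f T : IsSelfAdjoint (cfc f T)).isSymmetric.coe_re_inner_self_apply y
    have hfun : (fun t : ℝ => 1 / (s - t)) =ᵐ[μ]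
        fun t => (((s.re - t) * (N t)⁻¹ : ℝ) : ℂ) - β * (((N t)⁻¹ : ℝ) : ℂ) := by
      filter_upwards [show ∀ᵐ t ∂μ, t ∈ spectrum ℝ T from hsupp] with t ht
      have h4 : s - t ≠ 0 := sub_ne_zero.2 (hs t ht)
      have h5 : ((N t : ℝ) : ℂ) ≠ 0 := by exact_mod_cast hne t ht
      have h6 : (s - t) * ((s.re - t) - β) = N t := by
        have : s - t = (s.re - t) + β := by linear_combination hsβ
        rw [this, hN]
        push_cast at hββ ⊢
        linear_combination -hββ
      push_cast
      rw [div_eq_iff h4]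
      field_simp
      rw [← h6]
      ring
    rw [integral_congr_ae hfun, integral_sub (hintbleC _ hc1)
      ((hintbleC _ hwc).const_mul β), integral_const_mul, integral_complex_ofReal,
      integral_complex_ofReal, hint _ hc1, hint _ hwc, hreal, hreal,
      cfc_mul (fun t => s.re - t) (fun t => (N t)⁻¹) T (by fun_prop) hwc, ← hD, ← hW, sub_mul,
      sub_apply, inner_sub_right, smul_mul_assoc, one_mul, smul_apply, inner_smul_right]

end Spectral

/-! ### The group of translations and its generators -/

theorem inner_const_left {Ω : Type*} [MeasurableSpace Ω] {P : Measure Ω} [IsFiniteMeasure P] (c : ℂ) (f : Lp ℂ 2 P) :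
    inner ℂ (Lp.const 2 P c) f = starRingEnd ℂ c * ∫ ω, (f : Ω → ℂ) ω ∂P := by
  rw [L2.inner_def, ← integral_const_mul]
  refine integral_congr_ae ?_
  filter_upwards [Lp.coeFn_const 2 P c] with ω h
  rw [h]
  simp [mul_comm]

section Translations

variable {d : ℕ} {Ω : Type*} [MeasurableSpace Ω] (P : Measure Ω)
  [AddAction (EuclideanSpace ℝ (Fin d)) Ω] [MeasurableConstVAdd (EuclideanSpace ℝ (Fin d)) Ω]
  [VAddInvariantMeasure (EuclideanSpace ℝ (Fin d)) Ω P]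

theorem coeFn_translate (x : EuclideanSpace ℝ (Fin d)) (f : Lp ℂ 2 P) :
    (translate P x f : Ω → ℂ) =ᵐ[P] fun ω => (f : Ω → ℂ) (-x +ᵥ ω) :=
  Lp.coeFn_compMeasurePreserving f (measurePreserving_vadd (-x) P)

theorem translate_add (x y : EuclideanSpace ℝ (Fin d)) (f : Lp ℂ 2 P) :
    translate P (x + y) f = translate P x (translate P y f) := by
  refine Lp.ext ?_
  filter_upwards [coeFn_translate P (x + y) f, coeFn_translate P x (translate P y f),
    (measurePreserving_vadd (-x) P).quasiMeasurePreserving.ae (coeFn_translate P y f)]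
    with ω h1 h2 h3
  rw [h1, h2, h3, vadd_vadd, neg_add_rev]

theorem translate_zero (f : Lp ℂ 2 P) :
    translate P (0 : EuclideanSpace ℝ (Fin d)) f = f := by
  refine Lp.ext ?_
  filter_upwards [coeFn_translate P (0 : EuclideanSpace ℝ (Fin d)) f] with ω h1
  rw [h1, neg_zero, zero_vadd]

theorem translate_comm (x y : EuclideanSpace ℝ (Fin d)) (f : Lp ℂ 2 P) :
    translate P x (translate P y f) = translate P y (translate P x f) := by
  rw [← translate_add, add_comm, translate_add]

theorem inner_translate_left (x : EuclideanSpace ℝ (Fin d)) (f g : Lp ℂ 2 P) :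
    inner ℂ (translate P x f) g = inner ℂ f (translate P (-x) g) := by
  rw [← (translate P x).inner_map_map f, ← translate_add, add_neg_cancel, translate_zero]

theorem translate_const [IsFiniteMeasure P] (x : EuclideanSpace ℝ (Fin d)) (c : ℂ) :
    translate P x (Lp.const 2 P c) = Lp.const 2 P c := by
  refine Lp.ext ?_
  filter_upwards [coeFn_translate P x (Lp.const 2 P c), Lp.coeFn_const 2 P c,
    (measurePreserving_vadd (-x) P).quasiMeasurePreserving.ae (Lp.coeFn_const 2 P c)]
    with ω h1 h2 h3
  rw [h1, h2, h3]
  rfl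

theorem orbit_zero (i : Fin d) (f : Lp ℂ 2 P) : orbit P i f 0 = f := by
  rw [orbit, show EuclideanSpace.single i (0 : ℝ) = 0 by simp, translate_zero]

theorem orbit_translate (i : Fin d) (x : EuclideanSpace ℝ (Fin d)) (f : Lp ℂ 2 P) (t : ℝ) :
    orbit P i (translate P x f) t = translate P x (orbit P i f t) :=
  translate_comm P _ _ _

theorem inner_orbit_left (i : Fin d) (f g : Lp ℂ 2 P) (t : ℝ) :
    inner ℂ (orbit P i f t) g = inner ℂ f (orbit P i g (-t)) := by
  rw [orbit, inner_translate_left, orbit, ← PiLp.single_neg]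

variable {P}

theorem hasDerivAt_orbit_zero {i : Fin d} {f : Lp ℂ 2 P}
    (hf : DifferentiableAt ℝ (orbit P i f) 0) :
    HasDerivAt (orbit P i f) (generator P i f) 0 :=
  hf.hasDerivAt

theorem hasDerivAt_orbit_neg_zero {i : Fin d} {f : Lp ℂ 2 P}
    (hf : DifferentiableAt ℝ (orbit P i f) 0) :
    HasDerivAt (fun t => orbit P i f (-t)) (-generator P i f) 0 := by
  have h : HasDerivAt (orbit P i f) (generator P i f) (-0) := by
    rw [neg_zero]; exact hf.hasDerivAt
  have h1 := h.scomp (0 : ℝ) (hasDerivAt_neg 0)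
  rw [neg_one_smul] at h1
  exact h1

theorem hasDerivAt_orbit_translate {i : Fin d} {f : Lp ℂ 2 P}
    (hf : DifferentiableAt ℝ (orbit P i f) 0) (x : EuclideanSpace ℝ (Fin d)) :
    HasDerivAt (orbit P i (translate P x f)) (translate P x (generator P i f)) 0 := by
  have h := ((translate P x).toContinuousLinearMap.restrictScalars ℝ).hasFDerivAt.comp_hasDerivAt
    (0 : ℝ) hf.hasDerivAt
  refine h.congr_of_eventuallyEq (Eventually.of_forall fun t => ?_)
  exact orbit_translate P i x f t

theorem generator_translate {i : Fin d} {f : Lp ℂ 2 P}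
    (hf : DifferentiableAt ℝ (orbit P i f) 0) (x : EuclideanSpace ℝ (Fin d)) :
    generator P i (translate P x f) = translate P x (generator P i f) :=
  (hasDerivAt_orbit_translate hf x).deriv

theorem generator_sub {i : Fin d} {f g : Lp ℂ 2 P} (hf : DifferentiableAt ℝ (orbit P i f) 0)
    (hg : DifferentiableAt ℝ (orbit P i g) 0) :
    generator P i (f - g) = generator P i f - generator P i g := by
  have : orbit P i (f - g) = orbit P i f - orbit P i g := by funext t; exact map_sub _ _ _
  rw [generator, this]
  exact deriv_sub hf hg

/-- The generators are skew-adjoint. -/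
theorem inner_generator_left {i : Fin d} {f g : Lp ℂ 2 P}
    (hf : DifferentiableAt ℝ (orbit P i f) 0) (hg : DifferentiableAt ℝ (orbit P i g) 0) :
    inner ℂ (generator P i f) g = -inner ℂ f (generator P i g) := by
  have h1 := (hasDerivAt_orbit_zero hf).inner ℂ (hasDerivAt_const (0 : ℝ) g)
  have h2 := (hasDerivAt_const (0 : ℝ) f).inner ℂ (hasDerivAt_orbit_neg_zero hg)
  have h3 := h1.unique (h2.congr_of_eventuallyEq
    (Eventually.of_forall fun t => inner_orbit_left P i f g t))
  simpa using h3

/-- The generators commute weakly. -/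
theorem inner_generator_generator_comm {i j : Fin d} {f g : Lp ℂ 2 P}
    (hf : f ∈ generatorDomain (d := d) P) (hg : g ∈ generatorDomain (d := d) P) :
    inner ℂ (generator P i g) (generator P j f) = inner ℂ (generator P j g) (generator P i f) := by
  -- Second derivatives are avoided: both sides arise by differentiating at t = 0 the identity ⟨L_i
  -- g, T_t f⟩ = -⟨T_{-t} g, L_i f⟩, with T_t the translation along e_j, which uses only that L_i
  -- commutes with translations.
  have h1 := (hasDerivAt_const (0 : ℝ) (generator P i g)).inner ℂ (hasDerivAt_orbit_zero (hf j))
  have h2 := ((hasDerivAt_orbit_neg_zero (hg j)).inner ℂ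
    (hasDerivAt_const (0 : ℝ) (generator P i f))).neg
  have h3 := h1.unique (h2.congr_of_eventuallyEq (Eventually.of_forall fun t => ?_))
  · simpa using h3
  · change inner ℂ (generator P i g) (orbit P j f t) =
      -inner ℂ (orbit P j g (-t)) (generator P i f)
    have h4 := inner_orbit_left P j (generator P i g) f (-t)
    rw [neg_neg] at h4
    rw [← h4, orbit, ← generator_translate (hg i)]
    exact inner_generator_left (hasDerivAt_orbit_translate (hg i) _).differentiableAt (hf i)

/-! ### Constants and mean values -/

section Mean

variable [IsFiniteMeasure P]

theorem orbit_const (i : Fin d) (c : ℂ) : orbit P i (Lp.const 2 P c) = fun _ => Lp.const 2 P c := by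
  funext t
  exact translate_const P _ c

theorem const_mem_generatorDomain (c : ℂ) : Lp.const 2 P c ∈ generatorDomain (d := d) P :=
  fun i => by rw [orbit_const]; exact differentiableAt_const _

theorem generator_const (i : Fin d) (c : ℂ) : generator P i (Lp.const 2 P c) = 0 := by
  rw [generator, orbit_const, deriv_const]

theorem integral_eq_inner_const_one {Ω : Type*} [MeasurableSpace Ω] {P : Measure Ω}
    [IsFiniteMeasure P] (f : Lp ℂ 2 P) :
    ∫ ω, (f : Ω → ℂ) ω ∂P = inner ℂ (Lp.const 2 P (1 : ℂ)) f := by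
  rw [inner_const_left, RingHom.map_one, one_mul]

theorem integral_generator {i : Fin d} {f : Lp ℂ 2 P} (hf : DifferentiableAt ℝ (orbit P i f) 0) :
    ∫ ω, (generator P i f : Ω → ℂ) ω ∂P = 0 := by
  have h := inner_generator_left (const_mem_generatorDomain (1 : ℂ) i) hf
  rw [generator_const, inner_zero_left, inner_const_left] at h
  simpa using h.symm

end Mean

/-! ### Mollification along the orbits -/

section Mollify

variable (P)

/-- The average `∫ φ(x) T_{-x} f dx` of the translates of `f`. -/
def mollify (φ : ContDiffBump (0 : EuclideanSpace ℝ (Fin d))) (f : Lp ℂ 2 P) : Lp ℂ 2 P :=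
  convolution (φ.normed volume) (fun x => translate P x f) (ContinuousLinearMap.lsmul ℝ ℝ) volume 0

variable {P} (φ : ContDiffBump (0 : EuclideanSpace ℝ (Fin d)))

theorem mollify_eq (f : Lp ℂ 2 P) :
    mollify P φ f = ∫ t, φ.normed volume t • translate P (-t) f := by
  simp only [mollify, convolution_def, zero_sub]
  rfl

theorem translate_mollify_eq_convolution (f : Lp ℂ 2 P) (y : EuclideanSpace ℝ (Fin d)) :
    translate P y (mollify P φ f) = convolution (φ.normed volume) (fun x => translate P x f)
      (ContinuousLinearMap.lsmul ℝ ℝ) volume y := by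
  rw [mollify_eq, convolution_def, ← LinearIsometry.integral_comp_comm]
  refine integral_congr_ae (Eventually.of_forall fun t => ?_)
  change translate P y (φ.normed volume t • translate P (-t) f) =
    φ.normed volume t • translate P (y - t) f
  rw [sub_eq_add_neg, translate_add]
  exact ((translate P y).toLinearMap.restrictScalars ℝ).map_smul _ _

theorem translate_mollify (f : Lp ℂ 2 P) (y : EuclideanSpace ℝ (Fin d)) :
    translate P y (mollify P φ f) = mollify P φ (translate P y f) := by
  rw [translate_mollify_eq_convolution, mollify_eq, convolution_def]
  refine integral_congr_ae (Eventually.of_forall fun t => ?_)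
  change φ.normed volume t • translate P (y - t) f =
    φ.normed volume t • translate P (-t) (translate P y f)
  rw [← translate_add, neg_add_eq_sub]

/-- The orbit of a mollified element is itself the convolution of a smooth compactly supported bump
with a continuous function, hence differentiable. -/
theorem mollify_mem_generatorDomain
    (hcont : ∀ f : Lp ℂ 2 P, Continuous fun x : EuclideanSpace ℝ (Fin d) => translate P x f)
    (f : Lp ℂ 2 P) :
    mollify P φ f ∈ generatorDomain (d := d) P := fun i => by
  have h : ContDiff ℝ ((1 : ℕ∞) : WithTop ℕ∞) (convolution (φ.normed volume)
      (fun x => translate P x f) (ContinuousLinearMap.lsmul ℝ ℝ) volume) :=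
    φ.hasCompactSupport_normed.contDiff_convolution_left _ φ.contDiff_normed
      (hcont f).locallyIntegrable
  have h1 : orbit P i (mollify P φ f) = fun t => convolution (φ.normed volume)
      (fun x => translate P x f) (ContinuousLinearMap.lsmul ℝ ℝ) volume
      (EuclideanSpace.single i t) := by
    funext t
    exact translate_mollify_eq_convolution φ f _
  rw [h1]
  have h2 : Differentiable ℝ fun t : ℝ => EuclideanSpace.single i t := by
    rw [differentiable_piLp]
    intro k
    by_cases hk : k = i
    · subst hk; simp
    · simp [hk]
  exact ((h.differentiable (by simp)).comp h2) 0

theorem integrable_mollify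
    (hcont : ∀ f : Lp ℂ 2 P, Continuous fun x : EuclideanSpace ℝ (Fin d) => translate P x f)
    (f : Lp ℂ 2 P) :
    Integrable fun t => φ.normed volume t • translate P (-t) f :=
  (φ.continuous_normed.smul ((hcont f).comp continuous_neg)).integrable_of_hasCompactSupport
    φ.hasCompactSupport_normed.smul_right

/-- The bump is even and the adjoint of a translation is the inverse translation. -/
theorem inner_mollify_left
    (hcont : ∀ f : Lp ℂ 2 P, Continuous fun x : EuclideanSpace ℝ (Fin d) => translate P x f)
    (f g : Lp ℂ 2 P) :
    inner ℂ (mollify P φ f) g = inner ℂ f (mollify P φ g) := by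
  have key : ∀ f g : Lp ℂ 2 P, inner ℂ f (mollify P φ g) =
      ∫ t, (φ.normed volume t : ℂ) * inner ℂ f (translate P (-t) g) := fun f g => by
    rw [mollify_eq, ← integral_inner (integrable_mollify φ hcont g)]
    refine integral_congr_ae (Eventually.of_forall fun t => ?_)
    change inner ℂ f (((φ.normed volume t : ℝ) : ℂ) • translate P (-t) g) = _
    rw [inner_smul_right]
  rw [← inner_conj_symm, key, key, ← integral_conj, ← integral_neg_eq_self]
  refine integral_congr_ae (Eventually.of_forall fun t => ?_)
  simp only [map_mul, Complex.conj_ofReal, inner_conj_symm, ContDiffBump.normed_neg, neg_neg]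
  rw [inner_translate_left]

/-- Holds for arbitrary f and g in L². It converts weak curl and divergence conditions, tested on
mollified functions, into strong identities for the mollified field. -/
theorem inner_generator_mollify_left
    (hcont : ∀ f : Lp ℂ 2 P, Continuous fun x : EuclideanSpace ℝ (Fin d) => translate P x f)
    (i : Fin d) (f g : Lp ℂ 2 P) :
    inner ℂ (generator P i (mollify P φ f)) g =
      -inner ℂ f (generator P i (mollify P φ g)) := by
  have h1 := (hasDerivAt_orbit_zero (mollify_mem_generatorDomain φ hcont f i)).inner ℂ
    (hasDerivAt_const (0 : ℝ) g)
  have h2 := (hasDerivAt_const (0 : ℝ) f).inner ℂ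
    (hasDerivAt_orbit_neg_zero (mollify_mem_generatorDomain φ hcont g i))
  have h3 := h1.unique (h2.congr_of_eventuallyEq (Eventually.of_forall fun t => ?_))
  · simpa using h3
  · change inner ℂ (orbit P i (mollify P φ f) t) g = inner ℂ f (orbit P i (mollify P φ g) (-t))
    rw [inner_orbit_left, inner_mollify_left φ hcont, orbit, orbit, translate_mollify]

theorem mollify_const [IsFiniteMeasure P] (c : ℂ) :
    mollify P φ (Lp.const 2 P c) = Lp.const 2 P c := by
  rw [mollify_eq]
  simp_rw [translate_const]
  rw [integral_smul_const, φ.integral_normed, one_smul]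

theorem integral_mollify
    (hcont : ∀ f : Lp ℂ 2 P, Continuous fun x : EuclideanSpace ℝ (Fin d) => translate P x f)
    [IsFiniteMeasure P] (f : Lp ℂ 2 P) :
    ∫ ω, (mollify P φ f : Ω → ℂ) ω ∂P = ∫ ω, (f : Ω → ℂ) ω ∂P := by
  have h := inner_mollify_left φ hcont (Lp.const 2 P 1) f
  rw [mollify_const, inner_const_left, inner_const_left] at h
  simpa using h.symm

/-- The mollifications determine the function. -/
theorem eq_zero_of_forall_mollify_eq_zero
    (hcont : ∀ f : Lp ℂ 2 P, Continuous fun x : EuclideanSpace ℝ (Fin d) => translate P x f)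
    {f : Lp ℂ 2 P}
    (h : ∀ φ : ContDiffBump (0 : EuclideanSpace ℝ (Fin d)), mollify P φ f = 0) : f = 0 := by
  -- Outer radius 1/(n + 1), inner radius half of it: an approximate identity, so the mollifications
  -- converge to f by continuity of translations.
  let ψ : ℕ → ContDiffBump (0 : EuclideanSpace ℝ (Fin d)) := fun n =>
    ⟨1 / (2 * ((n : ℝ) + 1)), 1 / ((n : ℝ) + 1), by positivity, by
      gcongr; linarith [Nat.cast_nonneg (α := ℝ) n]⟩
  have h1 := ContDiffBump.convolution_tendsto_right_of_continuous (φ := ψ) (μ := volume)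
    (l := atTop) tendsto_one_div_add_atTop_nhds_zero_nat (hcont f) 0
  have h2 : ∀ n, convolution ((ψ n).normed volume) (fun x => translate P x f)
      (ContinuousLinearMap.lsmul ℝ ℝ) volume 0 = 0 := fun n => h (ψ n)
  simp_rw [h2, translate_zero] at h1
  exact tendsto_nhds_unique h1 tendsto_const_nhds

end Mollify

/-! ### Vanishing gradient implies translation invariance -/

section Ergodic

theorem translate_eq_self_of_generator_eq_zero {f : Lp ℂ 2 P}
    (hf : f ∈ generatorDomain (d := d) P) (h0 : ∀ i : Fin d, generator P i f = 0)
    (x : EuclideanSpace ℝ (Fin d)) : translate P x f = f := by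
  have h1 : ∀ (i : Fin d) (t : ℝ), translate P (EuclideanSpace.single i t) f = f := fun i t => by
    -- The group law transports the vanishing derivative from 0 to every s, so the orbit is
    -- constant. Translations along the axes then generate all translations.
    have hd : ∀ s, HasDerivAt (orbit P i f) 0 s := fun s => by
      have h := hasDerivAt_orbit_translate (hf i) (EuclideanSpace.single i s)
      rw [h0 i, map_zero] at h
      have h2 : HasDerivAt (fun t => orbit P i (translate P (EuclideanSpace.single i s) f) (t - s))
          0 s := by
        rw [← sub_self s] at h
        exact h.comp_sub_const s s
      refine h2.congr_of_eventuallyEq (Eventually.of_forall fun t => ?_)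
      change _ = translate P _ (translate P _ f)
      rw [← translate_add, ← PiLp.single_add, sub_add_cancel]
      rfl
    have h3 := is_const_of_deriv_eq_zero (fun s => (hd s).differentiableAt) (fun s => (hd s).deriv)
      t 0
    rwa [orbit_zero] at h3
  let S : AddSubmonoid (EuclideanSpace ℝ (Fin d)) :=
    { carrier := {x | translate P x f = f}
      add_mem' := fun {a b} ha hb => by
        rw [Set.mem_ofPred_eq] at ha hb ⊢
        rw [translate_add, hb, ha]
      zero_mem' := translate_zero P f }
  have h2 : x = ∑ i, EuclideanSpace.single i (x i) := by
    ext k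
    simp [Finset.sum_apply]
  rw [h2]
  exact S.sum_mem fun i _ => h1 i (x i)

end Ergodic

end Translations

/-! ### Curl-free fields are gradients -/

section CurlFree

variable {d : ℕ} {Ω : Type*} [MeasurableSpace Ω] {P : Measure Ω}
  [AddAction (EuclideanSpace ℝ (Fin d)) Ω] [MeasurableConstVAdd (EuclideanSpace ℝ (Fin d)) Ω]
  [ErgodicVAdd (EuclideanSpace ℝ (Fin d)) Ω P]

/-- Preimages of measurable sets are invariant up to null sets, hence null or conull by ergodicity.
As measurable sets of ℂ are countably separating, f is a.e. constant. -/
theorem eq_const_of_translate_eq_self [IsFiniteMeasure P] {f : Lp ℂ 2 P}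
    (h : ∀ x : EuclideanSpace ℝ (Fin d), translate P x f = f) : ∃ c : ℂ, f = Lp.const 2 P c := by
  have hm : AEMeasurable (f : Ω → ℂ) P := (Lp.aestronglyMeasurable f).aemeasurable
  obtain ⟨c, hc⟩ := exists_eventuallyEq_const_of_forall_separating (l := ae P) MeasurableSet
    (f := (f : Ω → ℂ)) fun U hU => by
      have h1 := aeconst_of_forall_preimage_vadd_ae_eq (EuclideanSpace ℝ (Fin d)) (μ := P)
        (hm.nullMeasurable hU) fun x => by
          have h2 := coeFn_translate P (-x) f
          rw [h, neg_neg] at h2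
          exact (h2.mono fun ω hω => by simp [← hω]).set_eq
      exact eventuallyConst_set.1 h1
  exact ⟨c, Lp.ext (hc.trans (Lp.coeFn_const 2 P c).symm)⟩

/-- The conditions defining `curlFree` are inner products against fixed vectors, hence closed. They
need checking only on genuine gradients, where the generators commute weakly and have mean zero. -/
theorem grad_mem_curlFree [IsFiniteMeasure P] (u : Sobolev d P) : grad d P u ∈ curlFree d P := by
  have hclosed : IsClosed {u : Sobolev d P | grad d P u ∈ curlFree d P} := by
    have hp : ∀ i, Continuous fun u : Sobolev d P => grad d P u i := fun i =>
      (PiLp.continuous_apply 2 _ i).comp (grad d P).continuous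
    have heq : {u : Sobolev d P | grad d P u ∈ curlFree d P} =
        (⋂ i, ⋂ j, ⋂ f, ⋂ (_ : f ∈ generatorDomain (d := d) P), {u : Sobolev d P |
          inner ℂ (generator P i f) (grad d P u j) - inner ℂ (generator P j f) (grad d P u i) = 0}) ∩
        {u : Sobolev d P | mean P (grad d P u) = 0} := by
      ext u
      simp [curlFree]
    rw [heq]
    refine IsClosed.inter ?_ ?_
    · refine isClosed_iInter fun i => isClosed_iInter fun j => isClosed_iInter fun f =>
        isClosed_iInter fun _ => isClosed_eq ?_ continuous_const
      exact (continuous_const.inner (hp j)).sub (continuous_const.inner (hp i))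
    · refine isClosed_eq (continuous_pi fun i => ?_) continuous_const
      have h : ∀ u : Sobolev d P, mean P (grad d P u) i =
          inner ℂ (Lp.const 2 P (1 : ℂ)) (grad d P u i) := fun u => by
        rw [← integral_eq_inner_const_one, mean]
      simp_rw [h]
      exact continuous_const.inner (hp i)
  refine (denseRange_toEnergy (gradient d P)).induction_on u hclosed fun f => ?_
  rw [grad_toEnergy]
  refine ⟨fun i j g hg => ?_, ?_⟩
  · exact sub_eq_zero.2 (inner_generator_generator_comm f.2.1 hg)
  · funext i
    exact integral_generator (f.2.1 i)

theorem eq_zero_of_generator_eq_zero [IsProbabilityMeasure P] {f : Lp ℂ 2 P}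
    (hf : f ∈ generatorDomain (d := d) P) (h0 : ∀ i : Fin d, generator P i f = 0)
    (hmean : ∫ ω, (f : Ω → ℂ) ω ∂P = 0) : f = 0 := by
  obtain ⟨c, rfl⟩ := eq_const_of_translate_eq_self (translate_eq_self_of_generator_eq_zero hf h0)
  rw [integral_congr_ae (Lp.coeFn_const 2 P c)] at hmean
  simp only [Function.const_apply, integral_const, probReal_univ, one_smul] at hmean
  rw [hmean, map_zero]

/-- A curl-free field that is orthogonal to all gradients vanishes. -/
theorem eq_zero_of_mem_curlFree_of_inner_gradient_eq_zero [IsProbabilityMeasure P]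
    (hcont : ∀ f : Lp ℂ 2 P, Continuous fun x : EuclideanSpace ℝ (Fin d) => translate P x f)
    {ξ : Field d P} (hξ : ξ ∈ curlFree d P)
    (hdiv : ∀ f : potentialDomain (d := d) P, inner ℂ (gradient d P f) ξ = 0) : ξ = 0 := by
  -- Subtracting its mean makes a test function admissible without changing its gradient; mollified
  -- functions need not have mean zero.
  have hdiv' : ∀ f ∈ generatorDomain (d := d) P, ∑ i, inner ℂ (generator P i f) (ξ i) = 0 := by
    intro f hf
    set c : ℂ := ∫ ω, (f : Ω → ℂ) ω ∂P with hc
    have hmem : f - Lp.const 2 P c ∈ potentialDomain (d := d) P := by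
      refine ⟨sub_mem hf (const_mem_generatorDomain c), ?_⟩
      rw [integral_eq_inner_const_one, inner_sub_right, inner_const_left, inner_const_left,
        integral_congr_ae (Lp.coeFn_const 2 P c)]
      simp [hc]
    have h2 := hdiv ⟨_, hmem⟩
    rw [PiLp.inner_apply] at h2
    rw [← h2]
    refine Finset.sum_congr rfl fun i _ => ?_
    change _ = inner ℂ (generator P i (f - Lp.const 2 P c)) (ξ i)
    rw [generator_sub (hf i) (const_mem_generatorDomain c i), generator_const, sub_zero]
  ext1 j
  refine eq_zero_of_forall_mollify_eq_zero hcont fun φ => ?_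
  set η : Fin d → Lp ℂ 2 P := fun i => mollify P φ (ξ i) with hη
  have hηd : ∀ i, η i ∈ generatorDomain (d := d) P := fun i =>
    mollify_mem_generatorDomain φ hcont _
  have hcurl : ∀ i j, generator P i (η j) = generator P j (η i) := fun i j => by
    refine ext_inner_left ℂ fun f => ?_
    have h := hξ.1 i j _ (mollify_mem_generatorDomain φ hcont f)
    rw [inner_generator_mollify_left φ hcont, inner_generator_mollify_left φ hcont] at h
    exact neg_injective (sub_eq_zero.1 h)
  have hdivη : ∑ i, generator P i (η i) = 0 := by
    refine ext_inner_left ℂ fun f => ?_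
    have h := hdiv' _ (mollify_mem_generatorDomain φ hcont f)
    simp_rw [inner_generator_mollify_left φ hcont] at h
    rw [Finset.sum_neg_distrib, neg_eq_zero] at h
    rw [inner_sum, inner_zero_right, h]
  -- Vanishing curl exchanges the indices in one factor, and weak commutation then turns the
  -- Dirichlet sum ∑ ‖L_i η_j‖² into ‖div η‖² = 0.
  have hsum : ∑ i : Fin d, ∑ j : Fin d, inner ℂ (generator P i (η j)) (generator P i (η j)) = 0 := by
    calc ∑ i : Fin d, ∑ j : Fin d, inner ℂ (generator P i (η j)) (generator P i (η j))
        = ∑ i : Fin d, ∑ j : Fin d, inner ℂ (generator P j (η j)) (generator P i (η i)) :=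
          Finset.sum_congr rfl fun i _ => Finset.sum_congr rfl fun j _ => by
            refine (congrArg (inner ℂ (generator P i (η j))) (hcurl i j)).trans ?_
            exact inner_generator_generator_comm (hηd i) (hηd j)
      _ = inner ℂ (∑ j, generator P j (η j)) (∑ i, generator P i (η i)) := by
          rw [inner_sum]
          simp_rw [sum_inner]
      _ = 0 := by rw [hdivη, inner_zero_left]
  have hre : ∑ i : Fin d, ∑ j : Fin d, ‖generator P i (η j)‖ ^ 2 = 0 := by
    simp_rw [inner_self_eq_norm_sq_to_K] at hsum
    refine (RCLike.ofReal_eq_zero (K := ℂ)).1 ?_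
    push_cast
    exact hsum
  refine eq_zero_of_generator_eq_zero (hηd j) (fun i => ?_) ?_
  · rw [Finset.sum_eq_zero_iff_of_nonneg fun i _ => by positivity] at hre
    have h := hre i (Finset.mem_univ i)
    rw [Finset.sum_eq_zero_iff_of_nonneg fun j _ => by positivity] at h
    simpa using h j (Finset.mem_univ j)
  · rw [integral_mollify φ hcont]
    exact congrFun hξ.2 j

/-- The curl-free fields of mean zero are the gradients of the potentials. -/
theorem mem_curlFree_iff [IsProbabilityMeasure P]
    (hcont : ∀ f : Lp ℂ 2 P, Continuous fun x : EuclideanSpace ℝ (Fin d) => translate P x f)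
    {ξ : Field d P} : ξ ∈ curlFree d P ↔ Gam d P ξ = ξ := by
  refine ⟨fun hξ => ?_, fun h => h ▸ grad_mem_curlFree _⟩
  have hG : Gam d P ξ ∈ curlFree d P := grad_mem_curlFree _
  refine (sub_eq_zero.1 (eq_zero_of_mem_curlFree_of_inner_gradient_eq_zero hcont
    (ξ := ξ - Gam d P ξ) ⟨fun i j f hf => ?_, ?_⟩ fun f => ?_)).symm
  · have h1 := hξ.1 i j f hf
    have h2 := hG.1 i j f hf
    rw [PiLp.sub_apply, PiLp.sub_apply, inner_sub_right, inner_sub_right]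
    linear_combination h1 - h2
  · funext i
    have h1 := congrFun hξ.2 i
    have h2 := congrFun hG.2 i
    simp only [mean, integral_eq_inner_const_one] at h1 h2 ⊢
    rw [PiLp.sub_apply, inner_sub_right, h1, h2, sub_self]
    rfl
  · rw [inner_sub_right, sub_eq_zero]
    exact (((invLaplaceDiv_eq_iff P ξ _).1 rfl) f).symm

end CurlFree

/-! ### Isometric intertwining of self-adjoint operators -/

section Intertwining

variable {H K : Type*} [NormedAddCommGroup H] [InnerProductSpace ℂ H] [CompleteSpace H]
  [NormedAddCommGroup K] [InnerProductSpace ℂ K] [CompleteSpace K]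
  {V : K →L[ℂ] H} {T : H →L[ℂ] H} {S : K →L[ℂ] K}

theorem adjoint_apply_apply_of_inner_map_map (hV : ∀ u v, inner ℂ (V u) (V v) = inner ℂ u v)
    (u : K) : V.adjoint (V u) = u :=
  ext_inner_left ℂ fun v => by rw [ContinuousLinearMap.adjoint_inner_right, hV]

theorem isSelfAdjoint_of_intertwining (hV : ∀ u v, inner ℂ (V u) (V v) = inner ℂ u v)
    (hT : IsSelfAdjoint T) (hVS : ∀ u, V (S u) = T (V u)) : IsSelfAdjoint S := by
  rw [ContinuousLinearMap.isSelfAdjoint_iff_isSymmetric]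
  intro u v
  rw [ContinuousLinearMap.coe_coe, ← hV, ← hV u, hVS, hVS,
    inner_apply_left_of_isSelfAdjoint hT]

/-- An isometry that intertwines two self-adjoint operators intertwines their resolutions of the
identity. -/
theorem IsResolutionOfIdentity.intertwining (hV : ∀ u v, inner ℂ (V u) (V v) = inner ℂ u v)
    (hT : IsSelfAdjoint T) (hVS : ∀ u, V (S u) = T (V u)) {Q : ℝ → H →L[ℂ] H}
    {Qt : ℝ → K →L[ℂ] K} (hQ : IsResolutionOfIdentity T Q) (hQt : IsResolutionOfIdentity S Qt)
    (t : ℝ) (u : K) : V (Qt t u) = Q t (V u) := by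
  have hS := isSelfAdjoint_of_intertwining hV hT hVS
  have hVV := adjoint_apply_apply_of_inner_map_map hV
  have hadj : ∀ x, V.adjoint (T x) = S (V.adjoint x) := fun x => by
    refine ext_inner_left ℂ fun v => ?_
    rw [ContinuousLinearMap.adjoint_inner_right, ← inner_apply_left_of_isSelfAdjoint hT, ← hVS,
      ← inner_apply_left_of_isSelfAdjoint hS, ContinuousLinearMap.adjoint_inner_right]
  -- VV* projects onto the range of V. Commuting with T, it commutes with every Q(t), so the
  -- compressions V*Q(t)V are still projections.
  have hcomm : Commute T (V.comp V.adjoint) := by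
    ext x
    change T (V (V.adjoint x)) = V (V.adjoint (T x))
    rw [hadj, hVS]
  have hQV : ∀ t x, Q t (V (V.adjoint x)) = V (V.adjoint (Q t x)) := fun t x => by
    rw [hQ.eq_spectralProjection hT]
    exact spectralProjection_apply_commute hT hcomm t x
  have hres : IsResolutionOfIdentity S fun t => (V.adjoint.comp (Q t)).comp V :=
    { isStarProjection := fun t => by
        have hp := hQ.isStarProjection t
        refine ⟨?_, ?_⟩
        · ext u
          change V.adjoint (Q t (V (V.adjoint (Q t (V u))))) = V.adjoint (Q t (V u))
          rw [hQV, hVV, isStarProjection_apply_apply hp]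
        · rw [ContinuousLinearMap.isSelfAdjoint_iff_isSymmetric]
          intro u v
          change inner ℂ (V.adjoint (Q t (V u))) v = inner ℂ u (V.adjoint (Q t (V v)))
          rw [ContinuousLinearMap.adjoint_inner_left, ContinuousLinearMap.adjoint_inner_right,
            inner_apply_left_of_isSelfAdjoint hp.isSelfAdjoint]
      comp_of_le := fun t u htu => by
        ext x
        change V.adjoint (Q t (V (V.adjoint (Q u (V x))))) = V.adjoint (Q t (V x))
        rw [hQV, hVV, hQ.apply_apply_of_le htu]
      tendsto_right := fun t x =>
        (V.adjoint.continuous.tendsto _).comp (hQ.tendsto_right t (V x))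
      tendsto_atBot := fun x => by
        have := (V.adjoint.continuous.tendsto _).comp (hQ.tendsto_atBot (V x))
        rwa [map_zero] at this
      tendsto_atTop := fun x => by
        have := (V.adjoint.continuous.tendsto _).comp (hQ.tendsto_atTop (V x))
        rwa [hVV] at this
      integral_eq := fun x => by
        obtain ⟨μ, ⟨hfin, hμ⟩, hint, h⟩ := hQ.integral_eq (V x)
        refine ⟨μ, ⟨hfin, fun t => ?_⟩, hint, ?_⟩
        · rw [← hμ]
          exact ContinuousLinearMap.adjoint_inner_right V _ _
        · rw [h, ← hVS, hV] }
  rw [hQt.unique hS hres]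
  change V (V.adjoint (Q t (V u))) = Q t (V u)
  rw [← hQV, hVV]

end Intertwining

/-! ### Compressions `X Γ X` of projections -/

section Compression

variable {H : Type*} [NormedAddCommGroup H] [InnerProductSpace ℂ H] [CompleteSpace H]
  {X Γ : H →L[ℂ] H}

theorem norm_apply_le_of_isStarProjection {p : H →L[ℂ] H} (hp : IsStarProjection p) (x : H) :
    ‖p x‖ ≤ ‖x‖ := by
  have := norm_sq_eq_add_of_isStarProjection hp x
  exact le_of_sq_le_sq (by nlinarith [sq_nonneg ‖x - p x‖]) (norm_nonneg _)

theorem isSelfAdjoint_compression (hX : IsStarProjection X) (hΓ : IsStarProjection Γ) :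
    IsSelfAdjoint (X.comp (Γ.comp X)) := by
  rw [ContinuousLinearMap.isSelfAdjoint_iff_isSymmetric]
  intro u v
  change inner ℂ (X (Γ (X u))) v = inner ℂ u (X (Γ (X v)))
  rw [inner_apply_left_of_isSelfAdjoint hX.isSelfAdjoint,
    inner_apply_left_of_isSelfAdjoint hΓ.isSelfAdjoint,
    inner_apply_left_of_isSelfAdjoint hX.isSelfAdjoint]

/-- The quadratic form of XΓX at x is ‖ΓXx‖², which lies between 0 and ‖x‖². -/
theorem spectrum_compression_subset (hX : IsStarProjection X) (hΓ : IsStarProjection Γ) :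
    spectrum ℝ (X.comp (Γ.comp X)) ⊆ Set.Icc 0 1 := by
  set M := X.comp (Γ.comp X) with hM
  have hs : IsSelfAdjoint M := isSelfAdjoint_compression hX hΓ
  have hinner : ∀ x, inner ℂ x (M x) = ((‖Γ (X x)‖ ^ 2 : ℝ) : ℂ) := fun x => by
    change inner ℂ x (X (Γ (X x))) = _
    rw [← inner_apply_left_of_isSelfAdjoint hX.isSelfAdjoint,
      inner_self_apply_of_isStarProjection hΓ]
  have h0 : 0 ≤ M := by
    rw [ContinuousLinearMap.nonneg_iff_isPositive, ContinuousLinearMap.isPositive_def']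
    refine ⟨hs, fun x => ?_⟩
    rw [ContinuousLinearMap.reApplyInnerSelf_apply, inner_apply_left_of_isSelfAdjoint hs, hinner]
    exact sq_nonneg _
  have h1 : M ≤ algebraMap ℝ _ 1 := by
    rw [map_one, ContinuousLinearMap.le_def, ContinuousLinearMap.isPositive_def']
    refine ⟨(IsSelfAdjoint.one _).sub hs, fun x => ?_⟩
    rw [ContinuousLinearMap.reApplyInnerSelf_apply, sub_apply, one_apply_eq_self, inner_sub_left,
      inner_apply_left_of_isSelfAdjoint hs, hinner, inner_self_eq_norm_sq_to_K, map_sub, sub_nonneg]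
    have h2 := (norm_apply_le_of_isStarProjection hΓ (X x)).trans
      (norm_apply_le_of_isStarProjection hX x)
    have h3 : ‖Γ (X x)‖ ^ 2 ≤ ‖x‖ ^ 2 := by gcongr
    norm_cast
  intro t ht
  exact ⟨spectrum_nonneg_of_nonneg h0 ht, (le_algebraMap_iff_spectrum_le (ha := hs)).1 h1 t ht⟩

/-- The resolvent equation reads s S(Xe) = X(e + ΓX S(Xe)). As s ≠ 0, S(Xe) is in the range of X. -/
theorem apply_resolvent_compression_apply (hX : IsStarProjection X) {s : ℂ} (hs : s ≠ 0)
    {S : H →L[ℂ] H} (hS1 : (s • 1 - X.comp (Γ.comp X)) * S = 1) (e : H) :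
    X (S (X e)) = S (X e) := by
  have h1 : s • S (X e) - X (Γ (X (S (X e)))) = X e :=
    congrArg (fun A : H →L[ℂ] H => A (X e)) hS1
  have h3 : S (X e) = s⁻¹ • X (e + Γ (X (S (X e)))) := by
    rw [map_add, ← sub_eq_iff_eq_add.1 h1, smul_smul, inv_mul_cancel₀ hs, one_smul]
  rw [h3, map_smul, ← h3, isStarProjection_apply_apply hX, ← h3]

theorem apply_add_resolvent_compression (hX : IsStarProjection X) {s : ℂ} (hs : s ≠ 0)
    {S : H →L[ℂ] H} (hS1 : (s • 1 - X.comp (Γ.comp X)) * S = 1) (e : H) :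
    s⁻¹ • X (e + Γ (S (X e))) = S (X e) := by
  have h1 : s • S (X e) - X (Γ (X (S (X e)))) = X e :=
    congrArg (fun A : H →L[ℂ] H => A (X e)) hS1
  rw [apply_resolvent_compression_apply hX hs hS1] at h1
  rw [map_add, ← sub_eq_iff_eq_add.1 h1, smul_smul, inv_mul_cancel₀ hs, one_smul]

/-- The solution of `E = s⁻¹ Γ X (e + E)` in terms of the resolvent of `X Γ X`. -/
theorem eq_smul_apply_add_iff (hX : IsStarProjection X) {s : ℂ} (hs : s ≠ 0)
    {S : H →L[ℂ] H} (hS1 : (s • 1 - X.comp (Γ.comp X)) * S = 1)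
    (hS2 : S * (s • 1 - X.comp (Γ.comp X)) = 1) (e E : H) :
    E = s⁻¹ • Γ (X (e + E)) ↔ E = Γ (S (X e)) := by
  have h2 : ∀ y, S (s • y - X (Γ (X y))) = y := fun y =>
    congrArg (fun A : H →L[ℂ] H => A y) hS2
  constructor
  · intro h
    -- With y = s⁻¹X(e + E) one has Xy = y and Γy = E, so (s - XΓX)y = X(e + E) - XE = Xe.
    have h3 : S (X e) = s⁻¹ • X (e + E) := by
      rw [← h2 (s⁻¹ • X (e + E)), smul_smul, mul_inv_cancel₀ hs, one_smul, map_smul X,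
        isStarProjection_apply_apply hX, map_smul Γ, ← h, map_add X e E, add_sub_cancel_right]
    rw [h3, map_smul, ← h]
  · intro h
    rw [← map_smul, h, apply_add_resolvent_compression hX hs hS1]

end Compression

/-! ### Multiplication by matrix fields -/

section MatrixFields

variable {d : ℕ} {Ω : Type*} [MeasurableSpace Ω] (P : Measure Ω)

theorem inner_mulOp_left (a : Ω → ℝ) (ha : Measurable a) (C : ℝ) (hC : ∀ ω, |a ω| ≤ C)
    (f g : Lp ℂ 2 P) : inner ℂ (mulOp P a ha C hC f) g = inner ℂ f (mulOp P a ha C hC g) := by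
  rw [L2.inner_def, L2.inner_def]
  refine integral_congr_ae ?_
  filter_upwards [mulOp_apply P a ha C hC f, mulOp_apply P a ha C hC g] with ω h1 h2
  rw [h1, h2]
  simp only [RCLike.inner_apply, map_mul, Complex.conj_ofReal]
  ring

theorem op_apply (R : Orientation d Ω) (C : Matrix (Fin d) (Fin d) ℝ) (ξ : Field d P) (i : Fin d) :
    R.op P C ξ i = ∑ j, mulOp P (fun ω => R.conj C ω i j) (R.measurable_conj C i j)
      (∑ l, ∑ k, |C k l|) (fun ω => R.abs_conj_le C ω i j) (ξ j) := by
  change (∑ j, _ : Field d P →L[ℂ] Lp ℂ 2 P) ξ = _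
  rw [sum_apply]
  rfl

theorem coeFn_op (R : Orientation d Ω) (C : Matrix (Fin d) (Fin d) ℝ) (ξ : Field d P) (i : Fin d) :
    (R.op P C ξ i : Ω → ℂ) =ᵐ[P] fun ω => ∑ j, (R.conj C ω i j : ℂ) * (ξ j : Ω → ℂ) ω := by
  rw [op_apply]
  refine (Lp.coeFn_fun_finsetSum _ _).trans ?_
  have h2 : ∀ᵐ ω ∂P, ∀ j, (mulOp P (fun ω => R.conj C ω i j) (R.measurable_conj C i j)
      (∑ l, ∑ k, |C k l|) (fun ω => R.abs_conj_le C ω i j) (ξ j) : Ω → ℂ) ω =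
      (R.conj C ω i j : ℂ) * (ξ j : Ω → ℂ) ω := ae_all_iff.2 fun j => mulOp_apply P _ _ _ _ _
  filter_upwards [h2] with ω h
  exact Finset.sum_congr rfl fun j _ => h j

/-- The inner factor R Rᵀ cancels by orthogonality. This is what makes X₁ idempotent. -/
theorem Orientation.conj_mul (R : Orientation d Ω) (A B : Matrix (Fin d) (Fin d) ℝ) (ω : Ω) :
    R.conj (A * B) ω = R.conj A ω * R.conj B ω := by
  have h : (R.rot ω : Matrix (Fin d) (Fin d) ℝ) *
      (R.rot ω : Matrix (Fin d) (Fin d) ℝ).transpose = 1 :=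
    (Matrix.mem_orthogonalGroup_iff _ _).1 (Matrix.mem_specialOrthogonalGroup_iff.1 (R.rot ω).2).1
  simp only [Orientation.conj]
  rw [show ∀ U V : Matrix (Fin d) (Fin d) ℝ, V.transpose * A * V * (V.transpose * B * U) =
    V.transpose * A * (V * V.transpose) * B * U by intros; simp only [Matrix.mul_assoc], h,
    Matrix.mul_one]
  simp only [Matrix.mul_assoc]

theorem Orientation.conj_add (R : Orientation d Ω) (A B : Matrix (Fin d) (Fin d) ℝ) (ω : Ω) :
    R.conj (A + B) ω = R.conj A ω + R.conj B ω := by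
  simp only [Orientation.conj, Matrix.mul_add, Matrix.add_mul]

theorem Orientation.conj_one (R : Orientation d Ω) (ω : Ω) : R.conj 1 ω = 1 := by
  rw [Orientation.conj, Matrix.mul_one]
  exact (Matrix.mem_orthogonalGroup_iff' _ _).1
    (Matrix.mem_specialOrthogonalGroup_iff.1 (R.rot ω).2).1

theorem Orientation.conj_apply_comm (R : Orientation d Ω) {C : Matrix (Fin d) (Fin d) ℝ}
    (hC : C.transpose = C) (ω : Ω) (i j : Fin d) : R.conj C ω i j = R.conj C ω j i := by
  have h : (R.conj C ω).transpose = R.conj C ω := by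
    simp only [Orientation.conj, Matrix.transpose_mul, Matrix.transpose_transpose, hC,
      Matrix.mul_assoc]
  exact congrFun (congrFun h j) i

theorem op_op (R : Orientation d Ω) (A B : Matrix (Fin d) (Fin d) ℝ) (ξ : Field d P) :
    R.op P A (R.op P B ξ) = R.op P (A * B) ξ := by
  ext1 i
  refine Lp.ext ?_
  filter_upwards [coeFn_op P R A (R.op P B ξ) i, coeFn_op P R (A * B) ξ i,
    ae_all_iff.2 fun j => coeFn_op P R B ξ j] with ω h1 h2 h3
  rw [h1, h2]
  simp_rw [h3, R.conj_mul, Matrix.mul_apply, Complex.ofReal_sum, Complex.ofReal_mul,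
    Finset.mul_sum, Finset.sum_mul]
  rw [Finset.sum_comm]
  exact Finset.sum_congr rfl fun j _ => Finset.sum_congr rfl fun k _ => by ring

theorem op_add (R : Orientation d Ω) (A B : Matrix (Fin d) (Fin d) ℝ) (ξ : Field d P) :
    R.op P (A + B) ξ = R.op P A ξ + R.op P B ξ := by
  ext1 i
  refine Lp.ext ?_
  filter_upwards [coeFn_op P R A ξ i, coeFn_op P R B ξ i, coeFn_op P R (A + B) ξ i,
    Lp.coeFn_add (R.op P A ξ i) (R.op P B ξ i)] with ω h1 h2 h3 h4
  rw [h3, PiLp.add_apply, h4, Pi.add_apply, h1, h2, ← Finset.sum_add_distrib]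
  simp_rw [R.conj_add, Matrix.add_apply, Complex.ofReal_add, add_mul]

theorem op_one (R : Orientation d Ω) (ξ : Field d P) : R.op P 1 ξ = ξ := by
  ext1 i
  refine Lp.ext ?_
  filter_upwards [coeFn_op P R 1 ξ i] with ω h
  rw [h]
  simp [R.conj_one, Matrix.one_apply, apply_ite Complex.ofReal]

theorem inner_op_left (R : Orientation d Ω) {C : Matrix (Fin d) (Fin d) ℝ}
    (hC : C.transpose = C) (ξ ζ : Field d P) :
    inner ℂ (R.op P C ξ) ζ = inner ℂ ξ (R.op P C ζ) := by
  simp_rw [PiLp.inner_apply, op_apply, sum_inner, inner_sum, inner_mulOp_left]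
  rw [Finset.sum_comm]
  simp_rw [R.conj_apply_comm hC]

variable [NeZero d] (R : Orientation d Ω)

theorem axisMatrix_mul_self : axisMatrix d * axisMatrix d = axisMatrix d := by
  rw [axisMatrix, Matrix.diagonal_mul_diagonal, Matrix.diagonal_eq_diagonal_iff]
  intro i
  by_cases h : i = 0
  · subst h; simp
  · simp [h]

theorem isStarProjection_X₁ : IsStarProjection (X₁ P R) := by
  refine ⟨?_, ?_⟩
  · ext1 ξ
    change R.op P _ (R.op P _ ξ) = R.op P _ ξ
    rw [op_op, axisMatrix_mul_self]
  · rw [ContinuousLinearMap.isSelfAdjoint_iff_isSymmetric]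
    exact fun ξ ζ => inner_op_left P R (Matrix.diagonal_transpose _) ξ ζ

theorem X₂_apply (ξ : Field d P) : X₂ P R ξ = ξ - X₁ P R ξ := by
  rw [eq_sub_iff_add_eq, X₁, X₂, ← op_add, sub_add_cancel, op_one]

end MatrixFields

/-! ### Extension by density to the energy completions -/

section Energy

variable {V F K : Type*} [AddCommGroup V] [Module ℂ V] [NormedAddCommGroup F]
  [InnerProductSpace ℂ F] [NormedAddCommGroup K] [NormedSpace ℂ K]

theorem energy_hom_ext (A : V →ₗ[ℂ] F) {f g : Energy A →L[ℂ] K}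
    (h : ∀ v, f (toEnergy A v) = g (toEnergy A v)) (u : Energy A) : f u = g u :=
  congrFun ((denseRange_toEnergy A).equalizer f.continuous g.continuous (funext h)) u

theorem inner_energyLift_energyLift [CompleteSpace F] (A : V →ₗ[ℂ] F) (C : ℝ) (hA : ∀ v, ‖A v‖ ≤ C * ‖A v‖)
    (u v : Energy A) :
    inner ℂ (energyLift A A C hA u) (energyLift A A C hA v) = inner ℂ u v := by
  refine (denseRange_toEnergy A).induction_on₂
    (p := fun u v => inner ℂ (energyLift A A C hA u) (energyLift A A C hA v) = inner ℂ u v)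
    (isClosed_eq (by fun_prop) (by fun_prop)) (fun f g => ?_) u v
  rw [inner_toEnergy, energyLift_toEnergy, energyLift_toEnergy]

end Energy

/-! ### The effective conductivity -/

section Conductivity

variable {d : ℕ} {Ω : Type*} [MeasurableSpace Ω] (P : Measure Ω)

theorem inner_constField [IsFiniteMeasure P] (e : EuclideanSpace ℂ (Fin d)) (ξ : Field d P) :
    inner ℂ (constField P d e) ξ = ∑ i, starRingEnd ℂ (e i) * mean P ξ i := by
  rw [PiLp.inner_apply]
  exact Finset.sum_congr rfl fun i _ => inner_const_left (e i) (ξ i)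

theorem mean_eq_inner_constField [IsFiniteMeasure P] (ξ : Field d P) (i : Fin d) :
    mean P ξ i = inner ℂ (constField P d (EuclideanSpace.single i 1)) ξ := by
  rw [inner_constField, Finset.sum_eq_single i]
  · simp
  · intro j _ hj
    simp [hj]
  · simp

theorem mean_constField [IsProbabilityMeasure P] (e : EuclideanSpace ℂ (Fin d)) (i : Fin d) :
    mean P (constField P d e) i = e i := by
  change ∫ ω, (Lp.const 2 P (e i) : Ω → ℂ) ω ∂P = e i
  rw [integral_congr_ae (Lp.coeFn_const 2 P (e i))]
  simp

theorem constField_eq_sum [IsFiniteMeasure P] (e : EuclideanSpace ℂ (Fin d)) :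
    constField P d e = ∑ k, e k • constField P d (EuclideanSpace.single k 1) := by
  simp_rw [← map_smul, ← map_sum]
  congr 1
  ext i
  simp [Pi.single_apply]

/-- X₂ = 1 - X₁ and σ₂s⁻¹ = σ₂ - σ₁, so only one of the two projections remains. -/
theorem conductivity_apply [NeZero d] (R : Orientation d Ω) {σ₁ σ₂ s : ℂ} (hσ₂ : σ₂ ≠ 0) (hs : s⁻¹ = 1 - σ₁ / σ₂) (ξ : Field d P) :
    conductivity P R σ₁ σ₂ ξ = σ₂ • (ξ - s⁻¹ • X₁ P R ξ) := by
  have h : σ₂ * s⁻¹ = σ₂ - σ₁ := by rw [hs]; field_simp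
  change σ₁ • X₁ P R ξ + σ₂ • X₂ P R ξ = _
  rw [X₂_apply, smul_sub, smul_sub, smul_smul, h, sub_smul]
  abel

variable [AddAction (EuclideanSpace ℝ (Fin d)) Ω]
  [MeasurableConstVAdd (EuclideanSpace ℝ (Fin d)) Ω]

/-! ### The projection Γ and the intertwining of M with X₁ΓX₁ -/

section Projection

variable [IsFiniteMeasure P] [VAddInvariantMeasure (EuclideanSpace ℝ (Fin d)) Ω P]

/-- Γ = VV* for the isometry V = ∇, and V*V = 1. -/
theorem isStarProjection_Gam : IsStarProjection (Gam d P) := by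
  have h := adjoint_apply_apply_of_inner_map_map (inner_grad (d := d) P)
  refine ⟨?_, ContinuousLinearMap.isSelfAdjoint_iff_isSymmetric.2 fun ξ ζ => ?_⟩
  · ext1 ξ
    change grad d P ((grad d P).adjoint (grad d P _)) = grad d P _
    rw [h]
  · change inner ℂ (grad d P ((grad d P).adjoint ξ)) ζ = inner ℂ ξ (grad d P ((grad d P).adjoint ζ))
    rw [← ContinuousLinearMap.adjoint_inner_right, ContinuousLinearMap.adjoint_inner_left]

/-- Gradients have mean zero, so they are orthogonal to constants. -/
theorem Gam_constField (e : EuclideanSpace ℂ (Fin d)) : Gam d P (constField P d e) = 0 := by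
  have h : invLaplaceDiv d P (constField P d e) = 0 := by
    refine (invLaplaceDiv_eq_iff P _ _).2 fun g => ?_
    rw [map_zero, inner_zero_right, ← inner_conj_symm, inner_constField]
    have h1 : ∀ i, mean P (gradient d P g) i = 0 := fun i => integral_generator (g.2.1 i)
    simp [h1]
  change grad d P (invLaplaceDiv d P (constField P d e)) = 0
  rw [h, map_zero]

theorem gradPotential_phi₀ (j : Fin d) {E₀ : ℂ} (hE₀ : E₀ ≠ 0) :
    gradPotential d P (E₀⁻¹ • phi₀ d P j E₀) = constField P d (EuclideanSpace.single j 1) := by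
  have h : E₀⁻¹ • phi₀ d P j E₀ = (EuclideanSpace.single j 1, 0) := by
    refine Prod.ext ?_ (smul_zero _)
    change E₀⁻¹ • EuclideanSpace.single j E₀ = EuclideanSpace.single j 1
    ext i
    by_cases hi : i = j <;> simp [hi, hE₀]
  rw [h]
  simp [gradPotential]

variable [NeZero d] (R : Orientation d Ω)

theorem X₁grad_toEnergy (f : Potential d P) :
    X₁grad P R (toEnergy (X₁gradPotential P R) f) = X₁ P R (gradPotential d P f) :=
  energyLift_toEnergy _ _ _ _ f

theorem inner_X₁grad (u v : SobolevX₁ P R) :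
    inner ℂ (X₁grad P R u) (X₁grad P R v) = inner ℂ u v :=
  inner_energyLift_energyLift _ _ _ u v

theorem X₁_gradPotential_invLaplaceDiv (ζ : Field d P) :
    X₁ P R (gradPotential d P (0, invLaplaceDiv d P (X₁ P R ζ))) =
      bfM P R (X₁ P R ζ) := by
  have h : gradPotential d P (0, invLaplaceDiv d P (X₁ P R ζ)) =
      grad d P (invLaplaceDiv d P (X₁ P R ζ)) := by simp [gradPotential]
  change _ = X₁ P R (Gam d P (X₁ P R (X₁ P R ζ)))
  rw [h, isStarProjection_apply_apply (isStarProjection_X₁ P R)]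
  rfl

theorem X₁grad_opM_toEnergy (f : Potential d P) :
    X₁grad P R (opM P R (toEnergy (X₁gradPotential P R) f)) =
      bfM P R (X₁grad P R (toEnergy (X₁gradPotential P R) f)) :=
  (congrArg (X₁grad P R) (opM_toEnergy P R f)).trans <| (X₁grad_toEnergy P R _).trans <|
    (X₁_gradPotential_invLaplaceDiv P R _).trans
      (congrArg (bfM P R) (X₁grad_toEnergy P R f).symm)

theorem X₁grad_opM (u : SobolevX₁ P R) : X₁grad P R (opM P R u) = bfM P R (X₁grad P R u) :=
  energy_hom_ext (X₁gradPotential P R) (f := (X₁grad P R).comp (opM P R))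
    (g := (bfM P R).comp (X₁grad P R)) (X₁grad_opM_toEnergy P R) u

theorem isSelfAdjoint_bfM : IsSelfAdjoint (bfM P R) :=
  isSelfAdjoint_compression (isStarProjection_X₁ P R) (isStarProjection_Gam P)

theorem isSelfAdjoint_opM : IsSelfAdjoint (opM P R) :=
  isSelfAdjoint_of_intertwining (inner_X₁grad P R) (isSelfAdjoint_bfM P R) (X₁grad_opM P R)

/-- Needed to carry X₁ across Q(t): the intertwining yields Q(t)X₁∇f, the stated relation has
X₁Q(t)∇f. -/
theorem commute_bfM_X₁ : Commute (bfM P R) (X₁ P R) := by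
  have h := isStarProjection_apply_apply (isStarProjection_X₁ P R)
  ext1 ξ
  change X₁ P R (Gam d P (X₁ P R (X₁ P R ξ))) = X₁ P R (X₁ P R (Gam d P (X₁ P R ξ)))
  rw [h, h]

variable {P R} in
theorem IsResolutionOfIdentity.apply_X₁ {Q : ℝ → Field d P →L[ℂ] Field d P}
    (hQ : IsResolutionOfIdentity (bfM P R) Q) (t : ℝ) (ξ : Field d P) :
    Q t (X₁ P R ξ) = X₁ P R (Q t ξ) := by
  rw [hQ.eq_spectralProjection (isSelfAdjoint_bfM P R)]
  exact spectralProjection_apply_commute (isSelfAdjoint_bfM P R) (commute_bfM_X₁ P R) t ξ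

end Projection

/-! ### The field equation solved by the resolvent of X₁ΓX₁ -/

section Effective

variable [IsProbabilityMeasure P] [ErgodicVAdd (EuclideanSpace ℝ (Fin d)) Ω P] [NeZero d]
  (R : Orientation d Ω)

/-- Since the curl-free fields form the range of Γ, the field problem says ΓE = E and Γσ(e + E) = 0.
Inserting σ = σ₂(1 - s⁻¹X₁) and Γe = 0 gives the equation, which conversely forces ΓE = E. -/
theorem isFluctuatingField_iff
    (hcont : ∀ f : Lp ℂ 2 P, Continuous fun x : EuclideanSpace ℝ (Fin d) => translate P x f)
    {σ₁ σ₂ s : ℂ} (hσ₂ : σ₂ ≠ 0) (hs : s⁻¹ = 1 - σ₁ / σ₂) (e : EuclideanSpace ℂ (Fin d))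
    (E : Field d P) : IsFluctuatingField P R σ₁ σ₂ e E ↔
      E = s⁻¹ • Gam d P (X₁ P R (constField P d e + E)) := by
  have hG := isStarProjection_Gam (d := d) P
  have hGσ : Gam d P E = E → Gam d P (conductivity P R σ₁ σ₂ (constField P d e + E)) =
      σ₂ • (E - s⁻¹ • Gam d P (X₁ P R (constField P d e + E))) := fun hE => by
    rw [conductivity_apply P R hσ₂ hs, map_smul, map_sub, map_add, Gam_constField, hE, zero_add,
      map_smul]
  have hE : IsFluctuatingField P R σ₁ σ₂ e E ↔ Gam d P E = E ∧
      Gam d P (conductivity P R σ₁ σ₂ (constField P d e + E)) = 0 := by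
    rw [IsFluctuatingField, mem_curlFree_iff hcont]
    refine and_congr_right fun _ => ⟨fun h => ?_, fun h ξ hξ => ?_⟩
    · refine ext_inner_left ℂ fun v => ?_
      rw [← inner_apply_left_of_isSelfAdjoint hG.isSelfAdjoint, inner_zero_right]
      exact h _ ((mem_curlFree_iff hcont).2 (isStarProjection_apply_apply hG v))
    · rw [← (mem_curlFree_iff hcont).1 hξ, inner_apply_left_of_isSelfAdjoint hG.isSelfAdjoint, h,
        inner_zero_right]
  rw [hE]
  constructor
  · rintro ⟨h1, h2⟩
    rw [hGσ h1, smul_eq_zero_iff_right hσ₂, sub_eq_zero] at h2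
    exact h2
  · intro h
    have h1 : Gam d P E = E := by
      rw [h, map_smul, isStarProjection_apply_apply hG]
    exact ⟨h1, by rw [hGσ h1, ← h, sub_self, smul_zero]⟩

theorem isFluctuatingField_iff_eq_resolvent
    (hcont : ∀ f : Lp ℂ 2 P, Continuous fun x : EuclideanSpace ℝ (Fin d) => translate P x f)
    {σ₁ σ₂ s : ℂ} (hσ₂ : σ₂ ≠ 0) (hs0 : s ≠ 0) (hs : s⁻¹ = 1 - σ₁ / σ₂)
    {S : Field d P →L[ℂ] Field d P} (hS1 : (s • 1 - bfM P R) * S = 1)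
    (hS2 : S * (s • 1 - bfM P R) = 1) (e : EuclideanSpace ℂ (Fin d)) (E : Field d P) :
    IsFluctuatingField P R σ₁ σ₂ e E ↔ E = Gam d P (S (X₁ P R (constField P d e))) := by
  rw [isFluctuatingField_iff P R hcont hσ₂ hs]
  exact eq_smul_apply_add_iff (isStarProjection_X₁ P R) hs0 hS1 hS2 _ _

/-- For the solution, s⁻¹X₁(e + E) = S X₁e, so the current is σ₂(e + E - S X₁e), and E has mean
zero. -/
theorem mean_conductivity_eq
    (hcont : ∀ f : Lp ℂ 2 P, Continuous fun x : EuclideanSpace ℝ (Fin d) => translate P x f)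
    {σ₁ σ₂ s : ℂ} (hσ₂ : σ₂ ≠ 0) (hs0 : s ≠ 0) (hs : s⁻¹ = 1 - σ₁ / σ₂)
    {S : Field d P →L[ℂ] Field d P} (hS1 : (s • 1 - bfM P R) * S = 1)
    (hS2 : S * (s • 1 - bfM P R) = 1) {e : EuclideanSpace ℂ (Fin d)} {E : Field d P}
    (hE : IsFluctuatingField P R σ₁ σ₂ e E) (i : Fin d) :
    mean P (conductivity P R σ₁ σ₂ (constField P d e + E)) i =
      σ₂ * (e i - inner ℂ (constField P d (EuclideanSpace.single i 1))
        (S (X₁ P R (constField P d e)))) := by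
  have hmean : inner ℂ (constField P d (EuclideanSpace.single i 1)) E = 0 := by
    rw [← mean_eq_inner_constField, hE.1.2]
    rfl
  have h1 := (isFluctuatingField_iff_eq_resolvent P R hcont hσ₂ hs0 hs hS1 hS2 e E).1 hE
  have h2 : s⁻¹ • X₁ P R (constField P d e + E) = S (X₁ P R (constField P d e)) := by
    rw [h1]
    exact apply_add_resolvent_compression (isStarProjection_X₁ P R) hs0 hS1 _
  rw [mean_eq_inner_constField, conductivity_apply P R hσ₂ hs, h2, inner_smul_right,
    inner_sub_right, inner_add_right, hmean, add_zero, ← mean_eq_inner_constField, mean_constField]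

theorem isEffectiveConductivity_iff
    (hcont : ∀ f : Lp ℂ 2 P, Continuous fun x : EuclideanSpace ℝ (Fin d) => translate P x f)
    {σ₁ σ₂ s : ℂ} (hσ₂ : σ₂ ≠ 0) (hs0 : s ≠ 0) (hs : s⁻¹ = 1 - σ₁ / σ₂)
    {S : Field d P →L[ℂ] Field d P} (hS1 : (s • 1 - bfM P R) * S = 1)
    (hS2 : S * (s • 1 - bfM P R) = 1) (A : Matrix (Fin d) (Fin d) ℂ) :
    IsEffectiveConductivity P R σ₁ σ₂ A ↔ A = Matrix.of fun i k =>
      σ₂ * ((1 : Matrix (Fin d) (Fin d) ℂ) i k -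
        inner ℂ (constField P d (EuclideanSpace.single i 1))
          (S (X₁ P R (constField P d (EuclideanSpace.single k 1))))) := by
  have hmean := fun e E hE i =>
    mean_conductivity_eq P R hcont hσ₂ hs0 hs hS1 hS2 (e := e) (E := E) hE i
  constructor
  · intro h
    ext i k
    -- Existence of a field for each basis vector is essential: the effective matrix is defined by a
    -- universal condition on fields and would otherwise be undetermined.
    have hE := (isFluctuatingField_iff_eq_resolvent P R hcont hσ₂ hs0 hs hS1 hS2
      (EuclideanSpace.single k 1) _).2 rfl
    have h1 := congrFun (h _ _ hE) i
    rw [hmean _ _ hE] at h1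
    rw [Matrix.of_apply, Matrix.one_apply]
    simp only [PiLp.single_apply] at h1
    rw [h1]
    simp [Matrix.mulVec, dotProduct]
  · rintro rfl e E hE
    funext i
    rw [hmean _ _ hE, constField_eq_sum P e]
    simp only [map_sum, map_smul, inner_sum, inner_smul_right, Matrix.mulVec, dotProduct,
      Matrix.of_apply, mul_sub, sub_mul, Finset.sum_sub_distrib, Finset.mul_sum]
    congr 1
    · simp [Matrix.one_apply]
    · exact Finset.sum_congr rfl fun k _ => by ring

end Effective

/-! ### Spectral measures and the integral representation -/

section Representation

variable [IsProbabilityMeasure P] [ErgodicVAdd (EuclideanSpace ℝ (Fin d)) Ω P] [NeZero d]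
  {P} {R : Orientation d Ω} {Q : ℝ → Field d P →L[ℂ] Field d P}
  {Qt : ℝ → SobolevX₁ P R →L[ℂ] SobolevX₁ P R}

theorem X₁grad_resolution_apply (hQ : IsResolutionOfIdentity (bfM P R) Q)
    (hQt : IsResolutionOfIdentity (opM P R) Qt) (t : ℝ) (f : Potential d P) :
    X₁grad P R (Qt t (toEnergy (X₁gradPotential P R) f)) =
      X₁ P R (Q t (gradPotential d P f)) :=
  (hQ.intertwining (inner_X₁grad P R) (isSelfAdjoint_bfM P R) (X₁grad_opM P R) hQt t _).trans <|
    (congrArg (Q t) (X₁grad_toEnergy P R f)).trans (hQ.apply_X₁ t _)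

theorem inner_toEnergy_resolution_apply (hQ : IsResolutionOfIdentity (bfM P R) Q)
    (hQt : IsResolutionOfIdentity (opM P R) Qt) (t : ℝ) (f : Potential d P) :
    inner ℂ (toEnergy (X₁gradPotential P R) f) (Qt t (toEnergy (X₁gradPotential P R) f)) =
      inner ℂ (gradPotential d P f) (Q t (X₁ P R (gradPotential d P f))) := by
  refine (inner_X₁grad P R _ _).symm.trans ((congrArg₂ (inner ℂ) (X₁grad_toEnergy P R f)
    (X₁grad_resolution_apply hQ hQt t f)).trans ?_)
  have hX := isStarProjection_X₁ P R
  rw [inner_apply_left_of_isSelfAdjoint hX.isSelfAdjoint, isStarProjection_apply_apply hX,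
    hQ.apply_X₁]

theorem inner_gradPotential_resolution_apply (hQ : IsResolutionOfIdentity (bfM P R) Q)
    (hQt : IsResolutionOfIdentity (opM P R) Qt) (t : ℝ) (f : Potential d P) :
    inner ℂ (gradPotential d P f) (X₁grad P R (Qt t (toEnergy (X₁gradPotential P R) f))) =
      inner ℂ (gradPotential d P f) (Q t (X₁ P R (gradPotential d P f))) :=
  congrArg (inner ℂ (gradPotential d P f))
    ((X₁grad_resolution_apply hQ hQt t f).trans (hQ.apply_X₁ t _).symm)

/-- The asymmetric form ⟨Q X₁e_j, e_j⟩ is really the quadratic form at X₁e_j, hence given by a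
positive spectral measure. -/
theorem inner_X₁_resolution_apply (hQ : IsResolutionOfIdentity (bfM P R) Q) (t : ℝ)
    (ξ : Field d P) :
    inner ℂ (X₁ P R ξ) (Q t (X₁ P R ξ)) = inner ℂ ξ (Q t (X₁ P R ξ)) := by
  have hX := isStarProjection_X₁ P R
  rw [inner_apply_left_of_isSelfAdjoint hX.isSelfAdjoint, ← hQ.apply_X₁,
    isStarProjection_apply_apply hX]

theorem spectrum_bfM_subset : spectrum ℝ (bfM P R) ⊆ Set.Icc 0 1 :=
  spectrum_compression_subset (isStarProjection_X₁ P R) (isStarProjection_Gam P)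

/-- If s = t with 0 < t ≤ 1, then h = 1 - 1/t ≤ 0, which the slit plane excludes; t = 0 is
impossible because s is an inverse. -/
theorem ne_ofReal_of_mem_Icc {h s : ℂ} (h1 : h ≠ 1) (hslit : h ∈ Complex.slitPlane)
    (hs : s = 1 / (1 - h)) {t : ℝ} (ht : t ∈ Set.Icc (0 : ℝ) 1) : s ≠ (t : ℂ) := by
  have hs0 : s ≠ 0 := by rw [hs]; exact one_div_ne_zero (sub_ne_zero.2 h1.symm)
  have hs' : s⁻¹ = 1 - h := by rw [hs, one_div, inv_inv]
  rintro rfl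
  have ht0 : 0 < t := lt_of_le_of_ne ht.1 fun h0 => hs0 (by rw [← h0, Complex.ofReal_zero])
  have h2 : h = ((1 - t⁻¹ : ℝ) : ℂ) := by
    push_cast
    rw [hs']
    ring
  rw [h2, Complex.ofReal_mem_slitPlane] at hslit
  have := (one_le_inv₀ ht0).2 ht.2
  linarith

/-- The integral representation of the effective conductivity. -/
theorem effectiveConductivity_integral_representation
    (hcont : ∀ f : Lp ℂ 2 P, Continuous fun x : EuclideanSpace ℝ (Fin d) => translate P x f)
    (hQ : IsResolutionOfIdentity (bfM P R) Q) (j : Fin d) {ν : Measure ℝ}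
    (hν : IsStieltjesMeasure ν fun t =>
      inner ℂ (constField P d (EuclideanSpace.single j 1))
        (Q t (X₁ P R (constField P d (EuclideanSpace.single j 1))))) :
    ν (Set.Icc 0 1)ᶜ = 0 ∧ ∀ σ₁ σ₂ s : ℂ, σ₂ ≠ 0 → σ₁ / σ₂ ≠ 1 → σ₁ / σ₂ ∈ Complex.slitPlane →
      s = 1 / (1 - σ₁ / σ₂) →
      (∀ e : EuclideanSpace ℂ (Fin d), ∃! Ef, IsFluctuatingField P R σ₁ σ₂ e Ef) ∧
      (∃! S, IsEffectiveConductivity P R σ₁ σ₂ S) ∧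
      ∀ S, IsEffectiveConductivity P R σ₁ σ₂ S →
        IntegrableOn (fun t : ℝ => 1 / (s - t)) (Set.Icc 0 1) ν ∧
        S j j / σ₂ = 1 - ∫ t in Set.Icc (0 : ℝ) 1, 1 / (s - t) ∂ν := by
  have hT := isSelfAdjoint_bfM P R
  have hX := isStarProjection_X₁ P R
  have hfin := hν.isFinite
  set c := constField P d (EuclideanSpace.single j 1) with hc
  simp_rw [← inner_X₁_resolution_apply hQ] at hν
  have hsupp : ν (Set.Icc 0 1)ᶜ = 0 :=
    measure_mono_null (Set.compl_subset_compl.2 spectrum_bfM_subset) (hν.spectral hT hQ).1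
  refine ⟨hsupp, fun σ₁ σ₂ s hσ₂ hne hslit hs => ?_⟩
  have hs0 : s ≠ 0 := by rw [hs]; exact one_div_ne_zero (sub_ne_zero.2 hne.symm)
  have hs' : s⁻¹ = 1 - σ₁ / σ₂ := by rw [hs, one_div, inv_inv]
  have hs01 : ∀ t ∈ Set.Icc (0 : ℝ) 1, s ≠ (t : ℂ) := fun t ht =>
    ne_ofReal_of_mem_Icc hne hslit hs ht
  obtain ⟨S, hS1, hS2, hS⟩ :=
    integral_one_div_sub_eq_inner_resolvent hT hQ fun t ht => hs01 t (spectrum_bfM_subset ht)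
  have heff := isEffectiveConductivity_iff P R hcont hσ₂ hs0 hs' hS1 hS2
  refine ⟨fun e => ?_, ?_, fun A hA => ⟨?_, ?_⟩⟩
  · simp_rw [isFluctuatingField_iff_eq_resolvent P R hcont hσ₂ hs0 hs' hS1 hS2]
    exact existsUnique_eq
  · simp_rw [heff]
    exact existsUnique_eq
  · refine ContinuousOn.integrableOn_compact isCompact_Icc ?_
    exact continuousOn_const.div (by fun_prop) fun t ht => sub_ne_zero.2 (hs01 t ht)
  -- The integral equals ⟨X₁c, S X₁c⟩. As S X₁c lies in the range of X₁, the left X₁ can be dropped,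
  -- leaving the diagonal entry of the effective matrix.
  · have hXS := apply_resolvent_compression_apply hX hs0 hS1 c
    rw [Measure.restrict_eq_self_of_ae_mem (show ∀ᵐ t ∂ν, t ∈ Set.Icc (0 : ℝ) 1 from hsupp),
      hS _ ν hν, inner_apply_left_of_isSelfAdjoint hX.isSelfAdjoint, hXS, (heff A).1 hA,
      Matrix.of_apply, Matrix.one_apply_eq, mul_div_cancel_left₀ _ hσ₂]

/-- All three distribution functions equal that of 𝐌 at X₁e_j, so the one spectral measure at that
vector serves for each. -/
theorem exists_spectralMeasure_phi₀
    (hQ : IsResolutionOfIdentity (bfM P R) Q) (hQt : IsResolutionOfIdentity (opM P R) Qt)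
    (j : Fin d) {E₀ : ℂ} (hE₀ : E₀ ≠ 0) : ∃ ν : Measure ℝ,
      IsStieltjesMeasure ν (fun t =>
        inner ℂ (toEnergy (X₁gradPotential P R) (E₀⁻¹ • phi₀ d P j E₀))
          (Qt t (toEnergy (X₁gradPotential P R) (E₀⁻¹ • phi₀ d P j E₀)))) ∧
      IsStieltjesMeasure ν (fun t =>
        inner ℂ (gradPotential d P (E₀⁻¹ • phi₀ d P j E₀))
          (X₁grad P R (Qt t (toEnergy (X₁gradPotential P R) (E₀⁻¹ • phi₀ d P j E₀))))) ∧
      IsStieltjesMeasure ν (fun t =>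
        inner ℂ (constField P d (EuclideanSpace.single j 1))
          (Q t (X₁ P R (constField P d (EuclideanSpace.single j 1))))) := by
  have hex := hQ.integral_eq (X₁ P R (constField P d (EuclideanSpace.single j 1)))
  have hg := gradPotential_phi₀ P j hE₀
  refine hex.elim fun ν hν => ⟨ν, ?_⟩
  have hν' : ∀ t, inner ℂ (constField P d (EuclideanSpace.single j 1))
      (Q t (X₁ P R (constField P d (EuclideanSpace.single j 1)))) = (ν.real (Set.Iic t) : ℂ) :=
    fun t => (inner_X₁_resolution_apply hQ t _).symm.trans (hν.1.eq_measure_Iic t)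
  refine ⟨⟨hν.1.isFinite, fun t => ?_⟩, ⟨hν.1.isFinite, fun t => ?_⟩, hν.1.isFinite, hν'⟩
  · refine (inner_toEnergy_resolution_apply hQ hQt t _).trans ?_
    rw [hg]
    exact hν' t
  · refine (inner_gradPotential_resolution_apply hQ hQt t _).trans ?_
    rw [hg]
    exact hν' t

end Representation

end Conductivity
end

end UniaxialComposite

open UniaxialComposite
theorem mainTheorem6 {d : ℕ} [NeZero d] {Ω : Type*} [MeasurableSpace Ω]
    [AddAction (EuclideanSpace ℝ (Fin d)) Ω] [MeasurableConstVAdd (EuclideanSpace ℝ (Fin d)) Ω]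
    (P : Measure Ω) [IsProbabilityMeasure P] [ErgodicVAdd (EuclideanSpace ℝ (Fin d)) Ω P]
    (hcont : ∀ f : Lp ℂ 2 P, Continuous fun x : EuclideanSpace ℝ (Fin d) => translate P x f)
    (R : Orientation d Ω) :
    IsSelfAdjoint (bfM P R) ∧ IsSelfAdjoint (opM P R) ∧
    (∃! Q, IsResolutionOfIdentity (bfM P R) Q) ∧
    (∃! Qt, IsResolutionOfIdentity (opM P R) Qt) ∧
    ∀ Q Qt, IsResolutionOfIdentity (bfM P R) Q → IsResolutionOfIdentity (opM P R) Qt →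
      -- `X₁ (∇ Q̃(t) - Q(t) ∇) = 0` on potentials
      (∀ (t : ℝ) (f : Potential d P),
        X₁grad P R (Qt t (toEnergy (X₁gradPotential P R) f)) =
          X₁ P R (Q t (gradPotential d P f))) ∧
      ∀ (j : Fin d) (E₀ : ℂ), E₀ ≠ 0 →
        ∃ ν μ : Measure ℝ,
          -- `dν = d⟨Q̃(t) φ₀/E₀, φ₀/E₀⟩ = d⟨X₁ ∇Q̃(t) φ₀/E₀, ∇φ₀/E₀⟩`
          IsStieltjesMeasure ν (fun t =>
            inner ℂ (toEnergy (X₁gradPotential P R) (E₀⁻¹ • phi₀ d P j E₀))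
              (Qt t (toEnergy (X₁gradPotential P R) (E₀⁻¹ • phi₀ d P j E₀)))) ∧
          IsStieltjesMeasure ν (fun t =>
            inner ℂ (gradPotential d P (E₀⁻¹ • phi₀ d P j E₀))
              (X₁grad P R (Qt t (toEnergy (X₁gradPotential P R) (E₀⁻¹ • phi₀ d P j E₀))))) ∧
          -- `dμ = d⟨Q(t) X₁ e_j, e_j⟩`
          IsStieltjesMeasure μ (fun t =>
            inner ℂ (constField P d (EuclideanSpace.single j 1))
              (Q t (X₁ P R (constField P d (EuclideanSpace.single j 1))))) ∧
          ν = μ ∧ ν (Set.Icc 0 1)ᶜ = 0 ∧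
          ∀ σ₁ σ₂ s : ℂ, σ₂ ≠ 0 → σ₁ / σ₂ ≠ 1 → σ₁ / σ₂ ∈ Complex.slitPlane →
            s = 1 / (1 - σ₁ / σ₂) →
            (∀ e : EuclideanSpace ℂ (Fin d), ∃! Ef, IsFluctuatingField P R σ₁ σ₂ e Ef) ∧
            (∃! S, IsEffectiveConductivity P R σ₁ σ₂ S) ∧
            ∀ S, IsEffectiveConductivity P R σ₁ σ₂ S →
              IntegrableOn (fun t : ℝ => 1 / (s - t)) (Set.Icc 0 1) ν ∧
              S j j / σ₂ = 1 - ∫ t in Set.Icc (0 : ℝ) 1, 1 / (s - t) ∂ν := by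
  refine ⟨isSelfAdjoint_bfM P R, ?_⟩
  refine ⟨isSelfAdjoint_opM P R, ?_⟩
  refine ⟨existsUnique_isResolutionOfIdentity (isSelfAdjoint_bfM P R), ?_⟩
  refine ⟨existsUnique_isResolutionOfIdentity (isSelfAdjoint_opM P R), ?_⟩
  intro Q Qt hQ hQt
  refine ⟨fun t f => X₁grad_resolution_apply hQ hQt t f, ?_⟩
  intro j E₀ hE₀
  refine (exists_spectralMeasure_phi₀ hQ hQt j hE₀).elim fun ν h => ⟨ν, ν, ?_⟩
  exact ⟨h.1, h.2.1, h.2.2, rfl,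
    effectiveConductivity_integral_representation hcont hQ j h.2.2⟩
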